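/- All schemes are over $\mathbb C$. Let $X$ be a smooth proper connected surface and $(X,D_X)$ a Calabi-Yau pair, i.e. $D_X$ is an effective integral Weil divisor with $D_X=-\mathrm{div}(\omega_X)$ for some rational $2$-form $\omega_X$ (unique up to a nonzero constant). Assume that $(X,D_X)$ is crepant birational to $(\mathbb P^2,\Delta)$, i.e. there is a birational map $\varphi: X\dashrightarrow\mathbb P^2$ with $\varphi^*\Omega=\lambda\,\omega_X$ for some $\lambda\in\mathbb C^*$, where $\Omega=\frac{dx_1}{x_1}\wedge\frac{dx_2}{x_2}$ in the chart $x_0\neq 0$ and $\Delta=-\mathrm{div}(\Omega)$ is the coordinate triangle. Let $G\leqslant\mathrm{Aut}(X,D_X)$ be a finite group of automorphisms of $X$ that multiply $\omega_X$ by nonzero constants. Let $f:Y\to X$ be a $G$-equivariant log resolution of $(X,D_X)$: $Y$ is smooth and connected with an action of $G$, $f$ is proper, birational and $G$-equivariant, and $\mathrm{Exc}(f)\cup f^{-1}(\mathrm{Supp}\,D_X)$ is a simple normal crossing divisor. Put $D_Y=-\mathrm{div}(f^*\omega_X)$, so that $K_Y+D_Y=f^*(K_X+D_X)$, and let $D_Y^{=1}$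 be the sum of the components of coefficient $1$ in $D_Y$. The dual complex $\mathcal D(X,D_X)=\mathcal D(D_Y^{=1})$ has one simplex with vertex set $I$ for each nonempty finite set $I$ of components of $D_Y^{=1}$ and each irreducible component of their intersection. Let $A\leqslant G$ be the kernel of the action of $G$ on $\mathcal D(X,D_X)$. Then $A$ is abelian of rank at most $2$, i.e. it can be generated by two elements. Moreover, there is a node $y$ of $D_Y^{=1}$, i.e. a point lying on two distinct components of $D_Y^{=1}$, such that $A$ fixes $y$ and $f(y)$, and acts faithfully, and by diagonal matrices in a suitable basis, both on $T_yY$ and on $T_{f(y)}X$. -/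

import Mathlib

open CategoryTheory AlgebraicGeometry Order

noncomputable section

namespace CYSurface

/-! ### Schemes over `ℂ`, local rings and function fields -/

/-- Schemes over the complex numbers; morphisms and automorphisms are over `ℂ`. -/
abbrev CScheme := Over (Spec (CommRingCat.of ℂ))

/-- The structure map from `ℂ` to the local ring of a complex scheme at a point. -/
def stalkStructure (X : CScheme) (x : X.left) :
    CommRingCat.of ℂ ⟶ X.left.presheaf.stalk x :=
  (Scheme.ΓSpecIso (CommRingCat.of ℂ)).inv ≫ X.hom.appTop ≫
    X.left.presheaf.germ ⊤ x (TopologicalSpace.Opens.mem_top x)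

/-- Local rings of a complex scheme, in particular its function field (the local ring at the
generic point), are complex algebras. -/
instance stalkAlgebra (X : CScheme) (x : X.left) : Algebra ℂ (X.left.presheaf.stalk x) :=
  (stalkStructure X x).hom.toAlgebra

theorem stalkStructure_stalkMap {X Y : CScheme} (f : Y ⟶ X) (y : Y.left) :
    stalkStructure X (f.left y) ≫ f.left.stalkMap y = stalkStructure Y y := by
  have h : X.hom.appTop ≫ f.left.appTop = Y.hom.appTop := by
    rw [← Scheme.Hom.comp_appTop, Over.w]
  have h' := f.left.germ_stalkMap ⊤ y (TopologicalSpace.Opens.mem_top (f.left y))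
  simp only [stalkStructure, Category.assoc]
  rw [h', ← h, Category.assoc]
  rfl

theorem stalkStructure_stalkSpecializes (X : CScheme) {x x' : X.left} (h : x ⤳ x') :
    stalkStructure X x' ≫ X.left.presheaf.stalkSpecializes h = stalkStructure X x := by
  have h' := X.left.presheaf.germ_stalkSpecializes (TopologicalSpace.Opens.mem_top x') h
  simp only [stalkStructure, Category.assoc]
  rw [h']

/-- Pullback of germs along `f : Y ⟶ X`, from the local ring at `x` to the local ring at `y`,
where `f y` is a generization of `x`. -/
def pullbackGerm {X Y : CScheme} (f : Y ⟶ X) (y : Y.left) (x : X.left) (h : f.left y ⤳ x) :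
    X.left.presheaf.stalk x →ₐ[ℂ] Y.left.presheaf.stalk y where
  __ := (X.left.presheaf.stalkSpecializes h ≫ f.left.stalkMap y).hom
  commutes' r := by
    have e : stalkStructure X x ≫ X.left.presheaf.stalkSpecializes h ≫ f.left.stalkMap y =
        stalkStructure Y y := by
      rw [← Category.assoc, stalkStructure_stalkSpecializes, stalkStructure_stalkMap]
    exact congrArg (fun φ => φ.hom r) e

theorem specializes_genericPoint {X Y : Scheme} [IrreducibleSpace X] [IrreducibleSpace Y]
    (f : Y ⟶ X) [IsDominant f] : f (genericPoint Y) ⤳ genericPoint X := by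
  have h := ((genericPoint_spec Y).image f.continuous)
  rw [Set.image_univ, f.denseRange.closure_range] at h
  exact h.specializes trivial

/-- The inclusion of function fields `K(X) → K(Y)` given by a dominant morphism `Y ⟶ X`. -/
def functionFieldMap {X Y : CScheme} [IsIntegral X.left] [IsIntegral Y.left] (f : Y ⟶ X)
    [IsDominant f.left] : X.left.functionField →ₐ[ℂ] Y.left.functionField :=
  pullbackGerm f (genericPoint Y.left) (genericPoint X.left) (specializes_genericPoint f.left)

/-! ### Rational 2-forms (volume forms on surfaces) and their divisors -/

open scoped KaehlerDifferential

/-- The form `da ∧ db`. -/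
def dWedge {K : Type} [CommRing K] [Algebra ℂ K] (a b : K) : ⋀[K]^2 Ω[K⁄ℂ] :=
  exteriorPower.ιMulti K 2 ![KaehlerDifferential.D ℂ K a, KaehlerDifferential.D ℂ K b]

/-- The map on 2-forms induced by a homomorphism of complex algebras. -/
def mapForm {K L : Type} [CommRing K] [CommRing L] [Algebra ℂ K] [Algebra ℂ L] (φ : K →ₐ[ℂ] L) :
    ⋀[K]^2 Ω[K⁄ℂ] →+ ⋀[L]^2 Ω[L⁄ℂ] :=
  letI : Algebra K L := φ.toRingHom.toAlgebra
  haveI : IsScalarTower ℂ K L := IsScalarTower.of_algebraMap_eq' φ.comp_algebraMap.symm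
  (exteriorPower.alternatingMapLinearEquiv
    { toMultilinearMap :=
        ((exteriorPower.ιMulti L 2 (M := Ω[L⁄ℂ])).toMultilinearMap.restrictScalars K).compLinearMap
          fun _ => KaehlerDifferential.map ℂ ℂ K L
      map_eq_zero_of_eq' := fun _ _ _ hv hij =>
        (exteriorPower.ιMulti L 2 (M := Ω[L⁄ℂ])).map_eq_zero_of_eq _
          (congrArg (KaehlerDifferential.map ℂ ℂ K L) hv) hij }).toAddMonoidHom

theorem mapForm_smul_dWedge {K L : Type} [CommRing K] [CommRing L] [Algebra ℂ K] [Algebra ℂ L]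
    (φ : K →ₐ[ℂ] L) (c a b : K) :
    mapForm φ (c • dWedge a b) = φ c • dWedge (φ a) (φ b) := by
  let : Algebra K L := φ.toRingHom.toAlgebra
  have : IsScalarTower ℂ K L := IsScalarTower.of_algebraMap_eq' φ.comp_algebraMap.symm
  have h : ∀ η, mapForm φ (c • η) = φ c • mapForm φ η := fun η => by
    simp only [mapForm, LinearMap.toAddMonoidHom_coe, map_smul]
    exact algebra_compatible_smul L c _
  rw [h]
  congr 1
  simp only [mapForm, dWedge, LinearMap.toAddMonoidHom_coe,
    exteriorPower.alternatingMapLinearEquiv_apply_ιMulti]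
  change exteriorPower.ιMulti L 2 _ = _
  congr 1
  ext i
  fin_cases i
  · exact KaehlerDifferential.map_D ℂ ℂ K L a
  · exact KaehlerDifferential.map_D ℂ ℂ K L b

/-- Rational 2-forms on an integral complex scheme. -/
abbrev RationalForm (X : CScheme) [IsIntegral X.left] : Type :=
  ⋀[X.left.functionField]^2 Ω[X.left.functionField⁄ℂ]

/-- Pullback of rational 2-forms along a dominant morphism. -/
def pullbackForm {X Y : CScheme} [IsIntegral X.left] [IsIntegral Y.left] (f : Y ⟶ X)
    [IsDominant f.left] : RationalForm X →+ RationalForm Y :=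
  mapForm (functionFieldMap f)

/-- The local ring at `x`, as a subring of the function field. -/
def localRing (X : CScheme) [IsIntegral X.left] (x : X.left) : Subring X.left.functionField :=
  (algebraMap (X.left.presheaf.stalk x) X.left.functionField).range

/-- The rational 2-forms that are regular at `x`: the module over the local ring at `x`
generated by the forms `da ∧ db` with `a`, `b` regular at `x`. -/
def regularForms (X : CScheme) [IsIntegral X.left] (x : X.left) :
    Submodule (localRing X x) (RationalForm X) :=
  Submodule.span (localRing X x)
    {η | ∃ a ∈ localRing X x, ∃ b ∈ localRing X x, η = dWedge a b}

/-- `D = - div ω` as Weil divisors on a normal complex surface: `D` is supported in codimension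
one, and if `t` is a uniformizer at a point `x` of codimension one, then `t ^ (D x) • ω`
generates the regular 2-forms at `x`. -/
def IsPoleDivisor (X : CScheme) [IsIntegral X.left] (ω : RationalForm X)
    (D : AlgebraicCycle X.left ℤ) : Prop :=
  (∀ x, coheight x ≠ 1 → D x = 0) ∧
  ∀ x, coheight x = 1 → ∀ t : X.left.presheaf.stalk x, Irreducible t →
    Submodule.span (localRing X x)
      {(algebraMap (X.left.presheaf.stalk x) X.left.functionField t) ^ (D x) • ω} =
      regularForms X x

/-- `(X, D)` is a Calabi-Yau pair (of dimension two): `X` is normal and proper, `D` is an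
effective Weil divisor, and `K_X + D ∼ 0`, that is, `D + div ω = 0` for some rational 2-form. -/
structure IsCalabiYauPair (X : CScheme) [IsIntegral X.left] (D : AlgebraicCycle X.left ℤ) :
    Prop where
  proper : IsProper X.hom
  normal : ∀ x : X.left, IsIntegrallyClosed (X.left.presheaf.stalk x)
  effective : ∀ x, 0 ≤ D x
  exists_form : ∃ ω : RationalForm X, IsPoleDivisor X ω D

instance (X : CScheme) (g : Aut X) : IsDominant g.hom.left :=
  haveI : IsIso g.hom.left := 
    haveI : IsIso (Iso.hom (X := X) (Y := X) g) := Iso.isIso_hom (X := X) (Y := X) g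
    inferInstanceAs (IsIso ((Over.forget _).map (Iso.hom (X := X) (Y := X) g)))
  inferInstance

/-- The automorphism `g` of `X` belongs to `Aut(X, D)`: it multiplies the volume form `ω`
with `D = - div ω` by a nonzero constant. -/
def IsPairAutomorphism (X : CScheme) [IsIntegral X.left] (D : AlgebraicCycle X.left ℤ)
    (g : Aut X) : Prop :=
  ∀ ω : RationalForm X, IsPoleDivisor X ω D →
    ∃ c : ℂ, c ≠ 0 ∧
      pullbackForm g.hom ω = algebraMap ℂ X.left.functionField c • ω

/-! ### Volume preserving birational maps -/

theorem isIntegral_opens {X : Scheme} [IsIntegral X] (U : X.Opens) (hU : Dense (U : Set X)) :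
    IsIntegral U.toScheme := by
  have : Nonempty U.toScheme := hU.nonempty.to_subtype
  exact isIntegral_of_isOpenImmersion U.ι

/-- The birational map `φ : X ⇢ Y` over `ℂ`, given by an isomorphism of dense open subschemes,
is volume preserving: `φ^* ω_Y = c ω_X` for a nonzero constant `c`. The two forms are compared on
the source of the isomorphism. -/
def IsVolumePreserving {X Y : CScheme} [IsIntegral X.left] [IsIntegral Y.left]
    (ωX : RationalForm X) (ωY : RationalForm Y) (φ : X.left.PartialIso Y.left)
    (hφ : φ.IsOver X.hom Y.hom) : Prop :=
  let U : CScheme := Over.mk (φ.source.ι ≫ X.hom)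
  let i : U ⟶ X := Over.homMk φ.source.ι rfl
  let j : U ⟶ Y := Over.homMk (φ.iso.hom ≫ φ.target.ι) 
    ((Category.assoc _ _ _).trans hφ)
  haveI : IsIntegral U.left := isIntegral_opens φ.source φ.dense_source
  haveI : IsDominant i.left := Opens.isDominant_ι φ.dense_source
  haveI : IsDominant φ.target.ι := Opens.isDominant_ι φ.dense_target
  haveI : IsDominant j.left := inferInstanceAs (IsDominant (φ.iso.hom ≫ φ.target.ι))
  ∃ c : ℂ, c ≠ 0 ∧
    pullbackForm j ωY = algebraMap ℂ U.left.functionField c • pullbackForm i ωX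

/-! ### The projective plane with its torus-invariant volume form -/

/-- The grading of `ℂ[x₀, x₁, x₂]` by degree. -/
abbrev planeGrading : ℕ → Submodule ℂ (MvPolynomial (Fin 3) ℂ) :=
  MvPolynomial.homogeneousSubmodule (Fin 3) ℂ

instance : GradedAlgebra planeGrading := MvPolynomial.gradedAlgebra

/-- The complex projective plane `Proj ℂ[x₀, x₁, x₂]`. -/
def Plane : CScheme :=
  Over.mk (Proj.toSpecZero planeGrading ≫
    Spec.map (CommRingCat.ofHom (algebraMap ℂ (planeGrading 0))))

theorem X_mem (i : Fin 3) : (MvPolynomial.X i : MvPolynomial (Fin 3) ℂ) ∈ planeGrading 1 :=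
  MvPolynomial.isHomogeneous_X ℂ i

/-- The chart `x₀ ≠ 0`. -/
def chart : Plane.left.Opens := Proj.basicOpen planeGrading (MvPolynomial.X 0)

/-- The generic point of the plane: the zero ideal. -/
def planePoint : Plane.left :=
  show ProjectiveSpectrum planeGrading from
  { asHomogeneousIdeal := ⊥
    isPrime := by
      change (⊥ : Ideal (MvPolynomial (Fin 3) ℂ)).IsPrime
      exact Ideal.isPrime_bot
    not_irrelevant_le := fun h => by
      have h0 : (MvPolynomial.X 0 : MvPolynomial (Fin 3) ℂ) ∈
          HomogeneousIdeal.irrelevant planeGrading :=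
        HomogeneousIdeal.mem_irrelevant_of_mem planeGrading one_pos (X_mem 0)
      have h1 : (MvPolynomial.X 0 : MvPolynomial (Fin 3) ℂ) = 0 := h h0
      exact MvPolynomial.X_ne_zero 0 h1 }

theorem planePoint_mem_basicOpen {p : MvPolynomial (Fin 3) ℂ} (hp : p ≠ 0) :
    planePoint ∈ (Proj.basicOpen planeGrading p : Plane.left.Opens) := by
  intro h
  exact hp h

theorem planePoint_mem {U : Set Plane.left} (hU : IsOpen U) (h : U.Nonempty) :
    planePoint ∈ U := by
  obtain ⟨x, hx⟩ := h
  obtain ⟨V, ⟨p, rfl⟩, hxV, hVU⟩ :=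
    (ProjectiveSpectrum.isTopologicalBasis_basic_opens planeGrading).exists_subset_of_mem_open
      hx hU
  refine hVU (planePoint_mem_basicOpen ?_)
  rintro rfl
  exact hxV (Ideal.zero_mem _)

instance : IrreducibleSpace Plane.left where
  isPreirreducible_univ U V hU hV hU' hV' :=
    ⟨planePoint, trivial, planePoint_mem hU (by simpa using hU'),
      planePoint_mem hV (by simpa using hV')⟩
  toNonempty := ⟨planePoint⟩

instance : IsReduced Plane.left := by
  have (x : Plane.left) : _root_.IsReduced (Plane.left.presheaf.stalk x) := by
    let x' : ProjectiveSpectrum planeGrading := x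
    let e := (Proj.stalkIso planeGrading x).commRingCatIsoToRingEquiv
    have h1 : _root_.IsReduced (HomogeneousLocalization.AtPrime planeGrading
        x'.asHomogeneousIdeal.toIdeal) := by
      have : IsDomain (Localization x'.asHomogeneousIdeal.toIdeal.primeCompl) :=
        IsLocalization.isDomain_localization (Ideal.primeCompl_le_nonZeroDivisors _)
      exact isReduced_of_injective
        (algebraMap _ (Localization x'.asHomogeneousIdeal.toIdeal.primeCompl))
        (HomogeneousLocalization.val_injective _)
    exact isReduced_of_injective e.toRingHom e.injective
  exact isReduced_of_isReduced_stalk _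

instance : IsIntegral Plane.left := isIntegral_of_irreducibleSpace_of_isReduced _

instance : Nonempty chart := ⟨⟨planePoint, planePoint_mem_basicOpen (MvPolynomial.X_ne_zero 0)⟩⟩

/-- The rational function `xᵢ / x₀` on the plane. -/
def coordinate (i : Fin 3) : Plane.left.functionField :=
  Plane.left.germToFunctionField chart
    (Proj.awayToSection planeGrading (MvPolynomial.X 0)
      (HomogeneousLocalization.Away.mk planeGrading (X_mem 0) 1 (MvPolynomial.X i)
        (by simpa using X_mem i)))

/-- The standard torus-invariant volume form `dx₁/x₁ ∧ dx₂/x₂` in the chart `x₀ ≠ 0`. -/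
def torusForm : RationalForm Plane :=
  ((coordinate 1)⁻¹ * (coordinate 2)⁻¹) • dWedge (coordinate 1) (coordinate 2)

/-- The pair `(X, D)` is crepant birational to `(ℙ², Δ)`, where `Δ = - div Ω` is the pole divisor
(the coordinate triangle) of the torus-invariant form `Ω`. -/
def IsCrepantBirationalToPlane (X : CScheme) [IsIntegral X.left]
    (D : AlgebraicCycle X.left ℤ) : Prop :=
  ∃ ω : RationalForm X, IsPoleDivisor X ω D ∧
    ∃ (φ : X.left.PartialIso Plane.left) (hφ : φ.IsOver X.hom Plane.hom),
      IsVolumePreserving ω torusForm φ hφ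

/-! ### Log resolutions and the dual complex -/

/-- The prime ideal, in the local ring at `y`, of the integral closed subscheme with
generic point `E` (through `y`). -/
def idealAt {Y : Scheme} {E y : Y} (h : E ⤳ y) : Ideal (Y.presheaf.stalk y) :=
  (IsLocalRing.maximalIdeal (Y.presheaf.stalk E)).comap (Y.presheaf.stalkSpecializes h).hom

/-- The prime divisors with generic points in `S` form a simple normal crossing divisor: at each
point `y` there is a regular system of parameters such that each of the divisors through `y`
is cut out by one of the parameters. -/
def IsSimpleNormalCrossing {Y : Scheme} (S : Set Y) : Prop :=
  ∀ y : Y, ∃ (n : ℕ) (t : Fin n → Y.presheaf.stalk y),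
    ringKrullDim (Y.presheaf.stalk y) = n ∧
    Ideal.span (Set.range t) = IsLocalRing.maximalIdeal (Y.presheaf.stalk y) ∧
    ∀ E ∈ S, ∀ h : E ⤳ y, ∃ i, idealAt h = Ideal.span {t i}

/-- The generic points of the prime divisors contained in `Exc(f) ∪ f⁻¹(Supp D)`, for a
proper birational morphism `f` to a normal scheme. -/
def boundaryDivisors {X Y : CScheme} (f : Y ⟶ X) (D : AlgebraicCycle X.left ℤ) : Set Y.left :=
  {E | coheight E = 1 ∧ (coheight (f.left E) ≠ 1 ∨ ∃ z, D z ≠ 0 ∧ z ⤳ f.left E)}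

/-- `f : Y ⟶ X` is a log resolution of the pair `(X, D)`, `X` a surface: `Y` is smooth, `f` is
proper and birational, and `Exc(f) ∪ f⁻¹(Supp D)` is a simple normal crossing divisor. -/
structure IsLogResolution {X Y : CScheme} (f : Y ⟶ X) (D : AlgebraicCycle X.left ℤ) : Prop where
  smooth : SmoothOfRelativeDimension 2 Y.hom
  proper : IsProper f.left
  birational : ∃ U : X.left.Opens, Dense (U : Set X.left) ∧ IsIso (f.left ∣_ U)
  snc : IsSimpleNormalCrossing (boundaryDivisors f D)

/-- `K_Y + D_Y = f^*(K_X + D_X)`: if `D_X = - div ω`, then `D_Y = - div (f^* ω)`. -/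
def IsCrepantPullback {X Y : CScheme} [IsIntegral X.left] [IsIntegral Y.left] (f : Y ⟶ X)
    [IsDominant f.left] (DX : AlgebraicCycle X.left ℤ) (DY : AlgebraicCycle Y.left ℤ) : Prop :=
  ∀ ω : RationalForm X, IsPoleDivisor X ω DX → IsPoleDivisor Y (pullbackForm f ω) DY

/-- The generic points of the components of `D^{=1}`, that is, of coefficient one in `D`. These are
the vertices of the dual complex. -/
def unitComponents {Y : Scheme} (D : AlgebraicCycle Y ℤ) : Set Y :=
  {E | coheight E = 1 ∧ D E = 1}

/-- The points of the dual complex of `D^{=1}`. For every nonempty finite set `I` of components of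
`D^{=1}` and every irreducible component `Z` (a stratum) of their intersection, there is a simplex
with vertex set `I`; its interior consists of the points with barycentric coordinates `weight E`
that are positive exactly for `E ∈ I`. The complex is the disjoint union of these open simplices;
the faces of the simplex of `Z` belong to the strata containing `Z`. -/
structure DualComplex {Y : Scheme} (D : AlgebraicCycle Y ℤ) where
  weight : Y →₀ ℝ
  support_subset : ∀ E ∈ weight.support, E ∈ unitComponents D
  weight_nonneg : ∀ E, 0 ≤ weight E
  weight_sum : ∑ E ∈ weight.support, weight E = 1
  stratum : Set Y
  maximal : Maximal (fun W : Set Y => IsIrreducible W ∧ W ⊆ ⋂ E ∈ weight.support, closure {E})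
    stratum

/-- The kernel of the action of `G` on the dual complex of `D^{=1}`, where an automorphism `g`
moves the point with stratum `Z` and barycentric coordinates `w` to the point with stratum `g Z`
and barycentric coordinates `w ∘ g⁻¹`. -/
def dualComplexKernel {G : Type*} [Group G] {Y : CScheme} (ρ : G →* Aut Y)
    (D : AlgebraicCycle Y.left ℤ) : Subgroup G where
  carrier := {g | ∀ p : DualComplex D,
    (ρ g).hom.left '' p.stratum = p.stratum ∧ ∀ E, p.weight ((ρ g).hom.left E) = p.weight E}
  one_mem' p := by
    have h : (⇑(ρ 1).hom.left : Y.left → Y.left) = id := by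
      rw [map_one]; rfl
    rw [h]
    exact ⟨Set.image_id _, fun _ => rfl⟩
  mul_mem' {a b} ha hb p := by
    have h : (⇑(ρ (a * b)).hom.left : Y.left → Y.left) = (ρ a).hom.left ∘ (ρ b).hom.left := by
      rw [map_mul]
      change ⇑((ρ b).hom ≫ (ρ a).hom).left = _
      ext x
      simp
    refine ⟨by rw [h, Set.image_comp, (hb p).1, (ha p).1], fun E => ?_⟩
    rw [h, Function.comp_apply, (ha p).2, (hb p).2]
  inv_mem' {a} ha p := by
    have h : (⇑(ρ a⁻¹).hom.left : Y.left → Y.left) ∘ (ρ a).hom.left = id := by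
      have e : ((ρ a).hom ≫ (ρ a⁻¹).hom) = 𝟙 Y := by
        rw [map_inv]; exact (ρ a).hom_inv_id
      ext x
      simpa using congrArg (fun k : Y ⟶ Y => k.left x) e
    have h' : (⇑(ρ a).hom.left : Y.left → Y.left) ∘ (ρ a⁻¹).hom.left = id := by
      have e : ((ρ a⁻¹).hom ≫ (ρ a).hom) = 𝟙 Y := by
        rw [map_inv]; exact (ρ a).inv_hom_id
      ext x
      simpa using congrArg (fun k : Y ⟶ Y => k.left x) e
    refine ⟨?_, fun E => ?_⟩
    · nth_rw 1 [← (ha p).1]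
      rw [← Set.image_comp, h, Set.image_id]
    · rw [← (ha p).2, ← Function.comp_apply (f := (ρ a).hom.left), h', id]

/-! ### Tangent representations -/

/-- The Zariski tangent space at a complex point, the dual of `𝔪 / 𝔪²`. -/
abbrev TangentSpace (X : CScheme) (x : X.left) : Type :=
  Module.Dual ℂ (IsLocalRing.maximalIdeal (X.left.presheaf.stalk x)).Cotangent

theorem maximalIdeal_le_comap_pullbackGerm {X : CScheme} (g : X ⟶ X) (x : X.left)
    (h : g.left x = x) :
    IsLocalRing.maximalIdeal (X.left.presheaf.stalk x) ≤
      (IsLocalRing.maximalIdeal (X.left.presheaf.stalk x)).comap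
        (pullbackGerm g x x (specializes_of_eq h)) := by
  have h1 : IsIso (X.left.presheaf.stalkSpecializes (specializes_of_eq h)) :=
    (X.left.presheaf.stalkCongr (.of_eq h.symm)).isIso_hom
  have h2 : IsLocalHom (X.left.presheaf.stalkSpecializes (specializes_of_eq h) ≫
      g.left.stalkMap x).hom := by
    rw [CommRingCat.hom_comp]
    infer_instance
  exact (((IsLocalRing.local_hom_TFAE _).out 0 3).mp h2)

/-- The differential at a fixed point of an endomorphism. -/
def tangentMap {X : CScheme} (g : X ⟶ X) (x : X.left) (h : g.left x = x) :
    TangentSpace X x →ₗ[ℂ] TangentSpace X x :=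
  (Ideal.mapCotangent _ _ (pullbackGerm g x x (specializes_of_eq h))
    (maximalIdeal_le_comap_pullbackGerm g x h)).dualMap

/-- A group acting on a surface `X` through `σ` fixes the point `x`, and acts on the tangent space
at `x` faithfully and by diagonal matrices in some basis. -/
def ActsFaithfullyAndDiagonallyAt {H : Type*} [Group H] {X : CScheme} (σ : H →* Aut X)
    (x : X.left) : Prop :=
  ∃ hx : ∀ h, (σ h).hom.left x = x,
    (∀ h, tangentMap (σ h).hom x (hx h) = LinearMap.id → h = 1) ∧
    ∃ b : Module.Basis (Fin 2) ℂ (TangentSpace X x),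
      ∀ h i, ∃ c : ℂ, tangentMap (σ h).hom x (hx h) (b i) = c • b i

/-- The closed point `y` lies on two distinct components of `D^{=1}`. -/
def IsNode {Y : Scheme} (D : AlgebraicCycle Y ℤ) (y : Y) : Prop :=
  IsClosed {y} ∧ ∃ E₁ ∈ unitComponents D, ∃ E₂ ∈ unitComponents D, E₁ ≠ E₂ ∧ E₁ ⤳ y ∧ E₂ ⤳ y

end CYSurface

end

noncomputable section

namespace CYSurface

open scoped KaehlerDifferential

/-! ### Two-forms over a field -/

section Forms

variable {K L M : Type} [CommRing K] [CommRing L] [CommRing M] [Algebra ℂ K] [Algebra ℂ L]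
  [Algebra ℂ M]

/-! The node is found as the centre of a valuation. Expand rational functions on the plane as series
in `x₁`, `x₂` with exponents in `ℤ × ℤ`, ordered lexicographically. This gives a valuation with
residue field `ℂ`, and the Euler derivations `xᵢ ∂/∂xᵢ` do not lower orders. Evaluated on these
derivations, a 2-form becomes a series, its `logCoefficient`. The coefficient of `Ω` is `1`, while
that of `da ∧ db` has order at least `ord a + ord b` (`le_orderTop_logCoefficient_dWedge`).

The crepant birational map and `f` carry the valuation to `K(Y)`, with `f^*ω` still of order zero.
As `Y` is proper, the valuation has a centre `y`, a closed point with residue field `ℂ`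
(`exists_center_of_algHom`). Let `t₁, t₂` be the parameters at `y` supplied by the normal crossing
condition. Only the curves `tᵢ = 0` can be poles of `f^*ω` near `y`, and their pole orders `aᵢ` are
at most one because `Ω` is logarithmic (`poleOrder_le_one`). Since functions extend over points of
codimension two, `t₁ t₂ f^*ω = z dt₁ ∧ dt₂`, where `z` is regular at `y` and divisible by `t₁^(1 -
a₁) t₂^(1 - a₂)`. Comparing orders gives `ord z ≤ 0`, so `z` is a unit and both `aᵢ` are one
(`eq_one_of_orderTop_eq_zero`): `y` is a node.

The node is a stratum of the dual complex, so the kernel `A` fixes `y` and both components through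
it (`fixes_of_fixes_dualComplex`). It preserves the ideals `(tᵢ)` and is therefore diagonal on
`T_yY`. An automorphism of finite order that is trivial on a cotangent space is trivial
(`eq_of_trivial_on_cotangent`), so `A` is faithful there. Hence two characters embed `A` in a torus,
which gives commutativity and rank at most two. At `f(y)`, faithfulness follows in the same way, and
a commuting family of operators of finite order is simultaneously diagonalizable. -/

theorem coe_dWedge (a b : K) :
    (dWedge a b : ExteriorAlgebra K Ω[K⁄ℂ]) =
      ExteriorAlgebra.ι K (KaehlerDifferential.D ℂ K a) *
        ExteriorAlgebra.ι K (KaehlerDifferential.D ℂ K b) := by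
  simp [dWedge, ExteriorAlgebra.ιMulti_apply]

theorem span_dWedge : Submodule.span K {η : ⋀[K]^2 Ω[K⁄ℂ] | ∃ a b, η = dWedge a b} = ⊤ := by
  rw [eq_top_iff, ← exteriorPower.ιMulti_span_of_span K 2 _
    (KaehlerDifferential.span_range_derivation ℂ K)]
  refine Submodule.span_mono ?_
  rintro _ ⟨v, hv, rfl⟩
  simp only [Set.mem_ofPred_eq, Set.range_subset_iff] at hv
  obtain ⟨a, ha⟩ := hv 0
  obtain ⟨b, hb⟩ := hv 1
  refine ⟨a, b, ?_⟩
  rw [dWedge, ha, hb]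
  congr 1
  ext i
  fin_cases i <;> rfl

/-- Scalars are part of the generators because `mapForm` is only additive and changes the base ring;
semilinearity is itself proved by this induction. -/
theorem form_induction {p : ⋀[K]^2 Ω[K⁄ℂ] → Prop} (zero : p 0)
    (add : ∀ η θ, p η → p θ → p (η + θ)) (smul : ∀ c a b : K, p (c • dWedge a b)) (η) : p η := by
  have h : η ∈ Submodule.span K {η : ⋀[K]^2 Ω[K⁄ℂ] | ∃ a b, η = dWedge a b} := by
    rw [span_dWedge]; trivial
  induction h using Submodule.closure_induction with
  | zero => exact zero
  | add x y _ _ hx hy => exact add x y hx hy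
  | smul_mem c x hx =>
    obtain ⟨a, b, rfl⟩ := hx
    exact smul c a b

theorem mapForm_comp (φ : K →ₐ[ℂ] L) (ψ : L →ₐ[ℂ] M) (η) :
    mapForm ψ (mapForm φ η) = mapForm (ψ.comp φ) η := by
  induction η using form_induction with
  | zero => simp
  | add η θ h h' => simp [h, h']
  | smul c a b => simp [mapForm_smul_dWedge]

theorem mapForm_smul (φ : K →ₐ[ℂ] L) (c : K) (η) :
    mapForm φ (c • η) = φ c • mapForm φ η := by
  induction η using form_induction with
  | zero => simp
  | add η θ h h' => simp [h, h', smul_add]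
  | smul c' a b => simp [smul_smul, mapForm_smul_dWedge]

theorem mapForm_dWedge (φ : K →ₐ[ℂ] L) (a b : K) :
    mapForm φ (dWedge a b) = dWedge (φ a) (φ b) := by
  simpa using mapForm_smul_dWedge φ 1 a b

theorem dWedge_eq_smul {a b s t : K} {p q p' q' : K}
    (ha : KaehlerDifferential.D ℂ K a =
      p • KaehlerDifferential.D ℂ K s + q • KaehlerDifferential.D ℂ K t)
    (hb : KaehlerDifferential.D ℂ K b =
      p' • KaehlerDifferential.D ℂ K s + q' • KaehlerDifferential.D ℂ K t) :
    dWedge a b = (p * q' - q * p') • dWedge s t := by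
  apply Subtype.ext
  rw [Submodule.coe_smul, coe_dWedge, coe_dWedge, ha, hb]
  have h := ExteriorAlgebra.ι_add_mul_swap (R := K) (KaehlerDifferential.D ℂ K s)
    (KaehlerDifferential.D ℂ K t)
  rw [← eq_neg_iff_add_eq_zero] at h
  simp only [map_add, map_smul, add_mul, mul_add, smul_mul_assoc, mul_smul_comm,
    ExteriorAlgebra.ι_sq_zero, h, smul_zero, zero_add, add_zero]
  module

theorem dWedge_self (a : K) : dWedge a a = (0 : ⋀[K]^2 Ω[K⁄ℂ]) := by
  apply Subtype.ext
  rw [coe_dWedge, ExteriorAlgebra.ι_sq_zero]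
  rfl

/-- The functional on two-forms given by a pair of derivations. -/
def formFunctional (D₁ D₂ : Derivation ℂ K K) : ⋀[K]^2 Ω[K⁄ℂ] →ₗ[K] K :=
  exteriorPower.alternatingMapLinearEquiv
    ((Matrix.detRowAlternating (n := Fin 2) (R := K)).compLinearMap
      (LinearMap.pi ![D₁.liftKaehlerDifferential, D₂.liftKaehlerDifferential]))

theorem formFunctional_dWedge (D₁ D₂ : Derivation ℂ K K) (a b : K) :
    formFunctional D₁ D₂ (dWedge a b) = D₁ a * D₂ b - D₂ a * D₁ b := by
  rw [formFunctional, dWedge, exteriorPower.alternatingMapLinearEquiv_apply_ιMulti]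
  refine (Matrix.det_fin_two _).trans ?_
  change D₁.liftKaehlerDifferential (KaehlerDifferential.D ℂ K a) *
      D₂.liftKaehlerDifferential (KaehlerDifferential.D ℂ K b) -
      D₂.liftKaehlerDifferential (KaehlerDifferential.D ℂ K a) *
      D₁.liftKaehlerDifferential (KaehlerDifferential.D ℂ K b) = _
  simp

end Forms

/-! ### Forms regular along a subring -/

section Regular

variable {K : Type} [Field K] [Algebra ℂ K]

/-- The module generated by the forms `da ∧ db` with `a`, `b` in a subring. -/
def regularSpan (R : Subring K) : Submodule R (⋀[K]^2 Ω[K⁄ℂ]) :=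
  Submodule.span R {η | ∃ a ∈ R, ∃ b ∈ R, η = dWedge a b}

theorem dWedge_mem_regularSpan {R : Subring K} {a b : K} (ha : a ∈ R) (hb : b ∈ R) :
    dWedge a b ∈ regularSpan R :=
  Submodule.subset_span ⟨a, ha, b, hb, rfl⟩

theorem smul_mem_of_mem {R : Subring K} {N : Submodule R (⋀[K]^2 Ω[K⁄ℂ])} {c : K} {η}
    (hc : c ∈ R) (hη : η ∈ N) : c • η ∈ N :=
  N.smul_mem ⟨c, hc⟩ hη

theorem mapForm_mem_regularSpan {L : Type} [Field L] [Algebra ℂ L] (φ : K →ₐ[ℂ] L)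
    {R : Subring K} {S : Subring L} (h : ∀ a ∈ R, φ a ∈ S) {η} (hη : η ∈ regularSpan R) :
    mapForm φ η ∈ regularSpan S := by
  induction hη using Submodule.span_induction with
  | mem x hx =>
    obtain ⟨a, ha, b, hb, rfl⟩ := hx
    rw [mapForm_dWedge]
    exact dWedge_mem_regularSpan (h a ha) (h b hb)
  | zero => simp
  | add x y _ _ hx hy => rw [map_add]; exact add_mem hx hy
  | smul c x _ hx =>
    change mapForm φ ((c : K) • x) ∈ _
    rw [mapForm_smul]
    exact smul_mem_of_mem (h c c.2) hx

/-- Localization of a bound on differentials. -/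
theorem D_mem_span_of_fractions {R S : Subring K} (hRS : R ≤ S) {T : Set Ω[K⁄ℂ]}
    (hR : ∀ a ∈ R, KaehlerDifferential.D ℂ K a ∈ Submodule.span R T)
    (hS : ∀ a ∈ S, ∃ p ∈ R, ∃ q ∈ R, q⁻¹ ∈ S ∧ a = p * q⁻¹) {a : K} (ha : a ∈ S) :
    KaehlerDifferential.D ℂ K a ∈ Submodule.span S T := by
  have key : ∀ x, x ∈ Submodule.span R T → x ∈ Submodule.span S T := by
    intro x hx
    induction hx using Submodule.span_induction with
    | mem x hx => exact Submodule.subset_span hx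
    | zero => exact zero_mem _
    | add x y _ _ hx hy => exact add_mem hx hy
    | smul c x _ hx => exact (Submodule.span S T).smul_mem ⟨c, hRS c.2⟩ hx
  obtain ⟨p, hp, q, hq, hq', rfl⟩ := hS a ha
  rw [Derivation.leibniz, Derivation.leibniz_inv, smul_smul]
  refine add_mem ((Submodule.span S T).smul_mem ⟨_, ?_⟩ (key _ (hR q hq)))
    ((Submodule.span S T).smul_mem ⟨_, hq'⟩ (key _ (hR p hp)))
  exact mul_mem (hRS hp) (neg_mem (pow_mem hq' 2))

/-- Each `da ∧ db` is `ds ∧ dt` times a 2×2 determinant with entries in `S`. Independence of `ds`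
and `dt` is not needed, and the case `s = t` is used later. -/
theorem exists_smul_of_mem_regularSpan {S : Subring K} {s t : K}
    (h : ∀ a ∈ S, KaehlerDifferential.D ℂ K a ∈ Submodule.span S
      {KaehlerDifferential.D ℂ K s, KaehlerDifferential.D ℂ K t}) {η}
    (hη : η ∈ regularSpan S) : ∃ c ∈ S, η = c • dWedge s t := by
  induction hη using Submodule.span_induction with
  | mem x hx =>
    obtain ⟨a, ha, b, hb, rfl⟩ := hx
    obtain ⟨p, q, hpq⟩ := Submodule.mem_span_pair.mp (h a ha)
    obtain ⟨p', q', hpq'⟩ := Submodule.mem_span_pair.mp (h b hb)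
    exact ⟨_, (p * q' - q * p').2, dWedge_eq_smul hpq.symm hpq'.symm⟩
  | zero => exact ⟨0, zero_mem _, by simp⟩
  | add x y _ _ hx hy =>
    obtain ⟨c, hc, rfl⟩ := hx
    obtain ⟨c', hc', rfl⟩ := hy
    exact ⟨c + c', add_mem hc hc', by rw [add_smul]⟩
  | smul c x _ hx =>
    obtain ⟨c', hc', rfl⟩ := hx
    refine ⟨c * c', mul_mem c.2 hc', ?_⟩
    rw [← smul_smul]
    rfl

/-- A logarithmic form has at most a simple pole along a discrete valuation ring. -/
theorem smul_logForm_mem_regularSpan {R : Subring K} {t : K} (ht : t ∈ R)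
    (hR : ∀ x : K, x ≠ 0 → ∃ u ∈ R, u⁻¹ ∈ R ∧ u ≠ 0 ∧ ∃ n : ℤ, x = u * t ^ n) {x y : K}
    (hx : x ≠ 0) (hy : y ≠ 0) (ht0 : t ≠ 0) :
    t • (x⁻¹ * y⁻¹) • (dWedge x y : ⋀[K]^2 Ω[K⁄ℂ]) ∈ regularSpan R := by
  obtain ⟨u, hu, hu', hu0, n, rfl⟩ := hR x hx
  obtain ⟨v, hv, hv', hv0, m, rfl⟩ := hR y hy
  have hD (w : K) (k : ℤ) : KaehlerDifferential.D ℂ K (w * t ^ k) =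
      (w * (k * t ^ (k - 1))) • KaehlerDifferential.D ℂ K t +
        t ^ k • KaehlerDifferential.D ℂ K w := by
    rw [Derivation.leibniz, Derivation.leibniz_zpow, ← Int.cast_smul_eq_zsmul K, smul_smul,
      smul_smul]
    ring_nf
  -- Expand `(dlog u + n dlog t) ∧ (dlog v + m dlog t)`: since `dlog t ∧ dlog t = 0`, each term has
  -- at most one factor `dlog t`, which a single `t` clears.
  have e : t • ((u * t ^ n)⁻¹ * (v * t ^ m)⁻¹) • dWedge (u * t ^ n) (v * t ^ m) =
      ((n : K) * v⁻¹) • dWedge t v - ((m : K) * u⁻¹) • dWedge t u +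
        (t * u⁻¹ * v⁻¹) • dWedge u v := by
    apply Subtype.ext
    simp only [Submodule.coe_smul, Submodule.coe_add, Submodule.coe_sub, coe_dWedge, hD]
    have h := ExteriorAlgebra.ι_add_mul_swap (R := K) (KaehlerDifferential.D ℂ K u)
      (KaehlerDifferential.D ℂ K t)
    rw [← eq_neg_iff_add_eq_zero] at h
    simp only [map_add, map_smul, add_mul, mul_add, smul_mul_assoc, mul_smul_comm,
      ExteriorAlgebra.ι_sq_zero, h, smul_zero, zero_add]
    simp only [zpow_sub_one₀ ht0]
    match_scalars <;> field_simp
  rw [e]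
  have hn (k : ℤ) : (k : K) ∈ R := intCast_mem R k
  refine add_mem (sub_mem ?_ ?_) ?_
  · exact smul_mem_of_mem (mul_mem (hn n) hv') (dWedge_mem_regularSpan ht hv)
  · exact smul_mem_of_mem (mul_mem (hn m) hu') (dWedge_mem_regularSpan ht hu)
  · exact smul_mem_of_mem (mul_mem (mul_mem ht hu') hv') (dWedge_mem_regularSpan hu hv)

end Regular

/-! ### A monomial valuation of rational rank two -/

/-- Hahn series with exponents in `ℤ × ℤ`, ordered lexicographically. -/
abbrev BiSeries : Type := HahnSeries (Lex (ℤ × ℤ)) ℂ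

namespace BiSeries

/-- The monomial with the given exponents. -/
def monomial (m n : ℤ) : BiSeries := HahnSeries.single (toLex (m, n)) 1

/-- The series whose coefficients are multiplied by the values of a function. -/
def scaleCoeff (w : Lex (ℤ × ℤ) → ℂ) (x : BiSeries) : BiSeries where
  coeff g := w g * x.coeff g
  isPWO_support' := x.isPWO_support.mono fun g hg hx => hg (by simp only [hx, mul_zero])

theorem support_scaleCoeff_subset (w : Lex (ℤ × ℤ) → ℂ) (x : BiSeries) :
    (scaleCoeff w x).support ⊆ x.support :=
  fun g hg hx => hg (by simp only [scaleCoeff, hx, mul_zero])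

/-- The logarithmic derivation with weight `w`. -/
def eulerDerivation (w : Lex (ℤ × ℤ) →+ ℂ) : Derivation ℂ BiSeries BiSeries :=
  Derivation.mk'
    { toFun := scaleCoeff w
      map_add' x y := by ext g; simp [scaleCoeff, mul_add]
      map_smul' c x := by ext g; simp [scaleCoeff]; ring }
    fun x y => by
      ext g
      simp only [LinearMap.coe_mk, AddHom.coe_mk, smul_eq_mul, HahnSeries.coeff_add]
      -- Scaling may shrink supports. Summing all three products over the supports of `x` and `y`
      -- reduces the Leibniz rule to `w (i + j) = w i + w j`, term by term.
      rw [HahnSeries.coeff_mul_right' y.isPWO_support (support_scaleCoeff_subset w y), mul_comm y,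
        HahnSeries.coeff_mul_left' x.isPWO_support (support_scaleCoeff_subset w x),
        ← Finset.sum_add_distrib]
      simp only [scaleCoeff]
      rw [HahnSeries.coeff_mul, Finset.mul_sum]
      refine Finset.sum_congr rfl fun ij hij => ?_
      obtain ⟨_, _, h⟩ := Finset.mem_antidiagonal.mp hij
      rw [← h, map_add]
      ring

@[simp]
theorem coeff_eulerDerivation (w : Lex (ℤ × ℤ) →+ ℂ) (x : BiSeries) (g) :
    (eulerDerivation w x).coeff g = w g * x.coeff g := rfl

/-- Scaling coefficients creates no new exponents. This property of logarithmic derivations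
underlies all estimates of orders of forms. -/
theorem orderTop_le_eulerDerivation (w : Lex (ℤ × ℤ) →+ ℂ) (x : BiSeries) :
    x.orderTop ≤ (eulerDerivation w x).orderTop := by
  rw [HahnSeries.le_orderTop_iff_forall]
  intro j hj
  rw [coeff_eulerDerivation, HahnSeries.coeff_eq_zero_of_lt_orderTop hj, mul_zero]

/-- The first exponent. -/
def fstWeight : Lex (ℤ × ℤ) →+ ℂ where
  toFun g := ((ofLex g).1 : ℂ)
  map_zero' := by simp
  map_add' := by simp

/-- The second exponent. -/
def sndWeight : Lex (ℤ × ℤ) →+ ℂ where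
  toFun g := ((ofLex g).2 : ℂ)
  map_zero' := by simp
  map_add' := by simp

theorem eulerDerivation_monomial (w : Lex (ℤ × ℤ) →+ ℂ) (m n : ℤ) :
    eulerDerivation w (monomial m n) = HahnSeries.C (w (toLex (m, n))) * monomial m n := by
  ext g
  rw [HahnSeries.C_mul_eq_smul]
  simp only [coeff_eulerDerivation, monomial, HahnSeries.coeff_single, HahnSeries.coeff_smul,
    smul_eq_mul]
  split_ifs with h <;> simp [h]

theorem orderTop_algebraMap {c : ℂ} (hc : c ≠ 0) :
    (algebraMap ℂ BiSeries c).orderTop = 0 := by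
  rw [HahnSeries.algebraMap_apply]
  exact HahnSeries.orderTop_single (by simpa using hc)

theorem zero_le_orderTop_algebraMap (c : ℂ) : 0 ≤ (algebraMap ℂ BiSeries c).orderTop := by
  rw [HahnSeries.algebraMap_apply]
  exact HahnSeries.orderTop_single_le

/-- The series of nonnegative order. -/
def integers : ValuationSubring BiSeries where
  carrier := {x | 0 ≤ x.orderTop}
  mul_mem' {x y} hx hy := by
    simp only [Set.mem_ofPred_eq, HahnSeries.orderTop_mul] at *
    exact add_nonneg hx hy
  one_mem' := by simp
  add_mem' {x y} hx hy := by
    simp only [Set.mem_ofPred_eq] at *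
    exact (le_min hx hy).trans HahnSeries.min_orderTop_le_orderTop_add
  zero_mem' := by simp
  neg_mem' {x} hx := by
    change 0 ≤ (-x).orderTop
    rwa [HahnSeries.orderTop_neg]
  mem_or_inv_mem' x := by
    by_cases hx : x = 0
    · simp [hx]
    · have h : x.orderTop + (x⁻¹).orderTop = 0 := by
        rw [← HahnSeries.orderTop_mul, mul_inv_cancel₀ hx, HahnSeries.orderTop_one]
      by_contra! h'
      simp only [Set.mem_ofPred_eq, not_le] at h'
      have := h ▸ add_le_add_left h'.1.le (x⁻¹).orderTop
      rw [zero_add] at this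
      exact absurd h'.2 this.not_gt

/-- Only the constant term has exponent zero, so the valuation ring has residue field `ℂ`. -/
theorem orderTop_sub_coeff_zero_pos {x : BiSeries} (hx : 0 ≤ x.orderTop) :
    0 < (x - algebraMap ℂ BiSeries (x.coeff 0)).orderTop := by
  by_contra! h
  have h1 : 0 ≤ (x - algebraMap ℂ BiSeries (x.coeff 0)).orderTop :=
    (le_min hx (zero_le_orderTop_algebraMap _)).trans HahnSeries.min_orderTop_le_orderTop_sub
  have h2 := le_antisymm h h1
  apply HahnSeries.coeff_orderTop_ne (g := 0) h2
  rw [HahnSeries.algebraMap_apply]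
  simp

/-- Distinct monomials have distinct exponents in `ℤ × ℤ`, so no cancellation occurs; injectivity of
the substitution follows. -/
theorem aeval_coeff (p : MvPolynomial (Fin 2) ℂ) (s : Fin 2 →₀ ℕ) :
    (MvPolynomial.aeval ![monomial 1 0, monomial 0 1] p).coeff (toLex ((s 0 : ℤ), (s 1 : ℤ))) =
      p.coeff s := by
  induction p using MvPolynomial.induction_on' with
  | monomial u a =>
    rw [MvPolynomial.aeval_monomial, Finsupp.prod_fintype _ _ (by simp), Fin.prod_univ_two,
      ← Algebra.smul_def, MvPolynomial.coeff_monomial]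
    have : monomial 1 0 ^ u 0 * monomial 0 1 ^ u 1 = monomial (u 0) (u 1) := by
      simp only [monomial, HahnSeries.single_pow, HahnSeries.single_mul_single, one_pow, mul_one]
      have : u 0 • toLex ((1 : ℤ), (0 : ℤ)) + u 1 • toLex ((0 : ℤ), (1 : ℤ)) =
          toLex ((u 0 : ℤ), (u 1 : ℤ)) := by
        apply (toLex (α := ℤ × ℤ)).symm.injective
        ext <;> simp
      rw [this]
    simp only [Matrix.cons_val_zero, Matrix.cons_val_one]
    rw [this, HahnSeries.coeff_smul, monomial,
      HahnSeries.coeff_single]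
    have : (toLex ((s 0 : ℤ), (s 1 : ℤ)) = toLex ((u 0 : ℤ), (u 1 : ℤ))) ↔ u = s := by
      simp [Finsupp.ext_iff, Fin.forall_fin_two, eq_comm]
    simp only [this]
    simp
  | add p q hp hq => simp [hp, hq]

theorem aeval_injective : Function.Injective
    (MvPolynomial.aeval ![monomial 1 0, monomial 0 1] : MvPolynomial (Fin 2) ℂ →ₐ[ℂ] BiSeries) := by
  intro p q h
  ext s
  rw [← aeval_coeff, h, aeval_coeff]

/-- The hypotheses make `K` the fraction field of a polynomial ring, to which an injection into a
field extends. The denominator `q` may be zero, as the quotient is then `0`. -/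
theorem exists_algHom {K : Type} [Field K] [Algebra ℂ K] (x₁ x₂ : K)
    (hinj : Function.Injective
      (MvPolynomial.aeval ![x₁, x₂] : MvPolynomial (Fin 2) ℂ →ₐ[ℂ] K))
    (hfrac : ∀ z : K, ∃ p q : MvPolynomial (Fin 2) ℂ,
      z = MvPolynomial.aeval ![x₁, x₂] p / MvPolynomial.aeval ![x₁, x₂] q) :
    ∃ ι : K →ₐ[ℂ] BiSeries, ι x₁ = monomial 1 0 ∧ ι x₂ = monomial 0 1 := by
  let : Algebra (MvPolynomial (Fin 2) ℂ) K := (MvPolynomial.aeval ![x₁, x₂]).toAlgebra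
  have : IsScalarTower ℂ (MvPolynomial (Fin 2) ℂ) K :=
    IsScalarTower.of_algebraMap_eq' (MvPolynomial.aeval ![x₁, x₂]).comp_algebraMap.symm
  have : FaithfulSMul (MvPolynomial (Fin 2) ℂ) K := (faithfulSMul_iff_algebraMap_injective _ _).mpr hinj
  have : IsFractionRing (MvPolynomial (Fin 2) ℂ) K :=
    IsFractionRing.of_field _ _ fun z => by
      obtain ⟨p, q, h⟩ := hfrac z
      exact ⟨p, q, h⟩
  let ι : K →ₐ[ℂ] BiSeries := IsFractionRing.liftAlgHom aeval_injective
  have h (i : Fin 2) : ι (![x₁, x₂] i) = ![monomial 1 0, monomial 0 1] i := by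
    have h1 : ![x₁, x₂] i = algebraMap (MvPolynomial (Fin 2) ℂ) K (MvPolynomial.X i) :=
      (MvPolynomial.aeval_X ![x₁, x₂] i).symm
    rw [h1]
    simp [ι]
  exact ⟨ι, h 0, h 1⟩

end BiSeries

/-- The value of a two-form relative to the logarithmic form. -/
def logCoefficient {K : Type} [Field K] [Algebra ℂ K] (ι : K →ₐ[ℂ] BiSeries) :
    ⋀[K]^2 Ω[K⁄ℂ] →+ BiSeries :=
  (formFunctional (BiSeries.eulerDerivation BiSeries.fstWeight)
    (BiSeries.eulerDerivation BiSeries.sndWeight)).toAddMonoidHom.comp (mapForm ι)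

section LogCoefficient

variable {K : Type} [Field K] [Algebra ℂ K] (ι : K →ₐ[ℂ] BiSeries)

theorem logCoefficient_smul (c : K) (η) :
    logCoefficient ι (c • η) = ι c * logCoefficient ι η := by
  simp [logCoefficient, mapForm_smul]

/-- The two Euler derivations are dual to `dlog x₁`, `dlog x₂`, so the determinant is that of the
identity matrix. -/
theorem logCoefficient_logForm {x₁ x₂ : K} (h₁ : ι x₁ = BiSeries.monomial 1 0)
    (h₂ : ι x₂ = BiSeries.monomial 0 1) :
    logCoefficient ι ((x₁⁻¹ * x₂⁻¹) • dWedge x₁ x₂) = 1 := by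
  have hx₁ : ι x₁ ≠ 0 := by rw [h₁]; exact HahnSeries.single_ne_zero one_ne_zero
  have hx₂ : ι x₂ ≠ 0 := by rw [h₂]; exact HahnSeries.single_ne_zero one_ne_zero
  rw [logCoefficient_smul]
  simp only [logCoefficient, AddMonoidHom.comp_apply, LinearMap.toAddMonoidHom_coe,
    mapForm_dWedge, formFunctional_dWedge, map_mul, map_inv₀]
  rw [h₁] at hx₁ ⊢
  rw [h₂] at hx₂ ⊢
  simp only [BiSeries.eulerDerivation_monomial, BiSeries.fstWeight, BiSeries.sndWeight,
    AddMonoidHom.coe_mk, ZeroHom.coe_mk, ofLex_toLex, Int.cast_one, Int.cast_zero, map_one,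
    map_zero, one_mul, zero_mul, sub_zero]
  field_simp

/-- Both products in the determinant `D₁a · D₂b - D₂a · D₁b` satisfy the bound, because Euler
derivations do not lower orders. -/
theorem le_orderTop_logCoefficient_dWedge (a b : K) :
    (ι a).orderTop + (ι b).orderTop ≤ (logCoefficient ι (dWedge a b)).orderTop := by
  simp only [logCoefficient, AddMonoidHom.comp_apply, LinearMap.toAddMonoidHom_coe,
    mapForm_dWedge, formFunctional_dWedge]
  refine le_trans (le_min ?_ ?_) HahnSeries.min_orderTop_le_orderTop_sub <;>
    refine le_trans ?_ HahnSeries.orderTop_add_le_mul <;>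
    exact add_le_add (BiSeries.orderTop_le_eulerDerivation _ _)
      (BiSeries.orderTop_le_eulerDerivation _ _)

end LogCoefficient

open IsLocalRing

/-! ### Local rings with residue field `ℂ` -/

section ResidueField

variable (O : Type) [CommRing O] [IsLocalRing O] [Algebra ℂ O]

/-- The residue field of the local `ℂ`-algebra `O` is `ℂ`. -/
def HasComplexResidue : Prop := ∀ a : O, ∃ c : ℂ, a - algebraMap ℂ O c ∈ maximalIdeal O

variable {O}

/-- Evaluation at the closed point. -/
def HasComplexResidue.eval (h : HasComplexResidue O) : O →ₐ[ℂ] ℂ :=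
  have hb : Function.Bijective (Algebra.ofId ℂ (ResidueField O)) := by
    refine ⟨(Algebra.ofId ℂ (ResidueField O)).toRingHom.injective, fun z => ?_⟩
    obtain ⟨a, rfl⟩ := residue_surjective z
    obtain ⟨c, hc⟩ := h a
    refine ⟨c, ?_⟩
    rw [← residue_eq_zero_iff, map_sub, sub_eq_zero] at hc
    rw [hc]
    rfl
  (AlgEquiv.ofBijective _ hb).symm.toAlgHom.comp (IsScalarTower.toAlgHom ℂ O (ResidueField O))

variable (h : HasComplexResidue O)
include h

theorem HasComplexResidue.eval_eq_zero_iff {a : O} : h.eval a = 0 ↔ a ∈ maximalIdeal O := by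
  rw [← residue_eq_zero_iff]
  simp [HasComplexResidue.eval]

theorem HasComplexResidue.sub_eval_mem (a : O) :
    a - algebraMap ℂ O (h.eval a) ∈ maximalIdeal O := by
  rw [← h.eval_eq_zero_iff]
  simp

theorem HasComplexResidue.smul_cotangent (a : O) (x : (maximalIdeal O).Cotangent) :
    a • x = h.eval a • x := by
  rw [← sub_eq_zero, ← algebraMap_smul O (h.eval a) x, ← sub_smul]
  exact Ideal.Cotangent.smul_eq_zero_of_mem (h.sub_eval_mem a) x

/-- The universal derivation to the cotangent space at the closed point. -/
def HasComplexResidue.cotangentDerivation :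
    Derivation ℂ O (maximalIdeal O).Cotangent :=
  Derivation.mk'
    { toFun a := (maximalIdeal O).toCotangent ⟨_, h.sub_eval_mem a⟩
      map_add' a b := by
        rw [← map_add]
        congr 1
        ext
        simp
        ring
      map_smul' c a := by
        rw [RingHom.id_apply, ← algebraMap_smul O c (Ideal.toCotangent _ _), ← map_smul]
        congr 1
        ext
        simp [Algebra.smul_def, mul_sub] }
    fun a b => by
      simp only [LinearMap.coe_mk, AddHom.coe_mk]
      rw [h.smul_cotangent b, ← algebraMap_smul O (h.eval b), ← map_smul, ← map_smul, ← map_add]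
      congr 1
      ext
      simp [Algebra.smul_def]
      ring

theorem HasComplexResidue.cotangentDerivation_apply (a : maximalIdeal O) :
    h.cotangentDerivation a = (maximalIdeal O).toCotangent a := by
  change (maximalIdeal O).toCotangent ⟨_, _⟩ = _
  congr 1
  ext
  simp [h.eval_eq_zero_iff.mpr a.2]

/-- This is the injectivity of `Ω / 𝔪Ω → 𝔪 / 𝔪²`. The map `a ↦ da` in the opposite direction is well
defined on `𝔪 / 𝔪²` and is a left inverse. -/
theorem HasComplexResidue.mem_smul_top_of_lift_eq_zero {w : Ω[O⁄ℂ]}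
    (hw : h.cotangentDerivation.liftKaehlerDifferential w = 0) :
    w ∈ (maximalIdeal O • ⊤ : Submodule O Ω[O⁄ℂ]) := by
  let r₀ : maximalIdeal O →ₗ[O] Ω[O⁄ℂ] ⧸ (maximalIdeal O • ⊤ : Submodule O Ω[O⁄ℂ]) :=
    { toFun a := Submodule.Quotient.mk (KaehlerDifferential.D ℂ O a)
      map_add' a b := by simp
      map_smul' a b := by
        rw [RingHom.id_apply, ← Submodule.Quotient.mk_smul, ← sub_eq_zero,
          ← Submodule.Quotient.mk_sub, Submodule.Quotient.mk_eq_zero]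
        simp only [SetLike.val_smul, smul_eq_mul, Derivation.leibniz, add_sub_cancel_left]
        exact Submodule.smul_mem_smul b.2 trivial }
  let r := Ideal.Cotangent.lift r₀ fun a b => by
    change Submodule.Quotient.mk _ = _
    rw [Submodule.Quotient.mk_eq_zero]
    simp only [MulMemClass.coe_mul, Derivation.leibniz]
    exact add_mem (Submodule.smul_mem_smul a.2 trivial) (Submodule.smul_mem_smul b.2 trivial)
  -- It suffices to compare on differentials, where `da = d(a - a(y))` because constants have zero
  -- differential.
  have hr : r ∘ₗ h.cotangentDerivation.liftKaehlerDifferential = Submodule.mkQ _ := by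
    apply Derivation.liftKaehlerDifferential_unique
    ext a
    change r (h.cotangentDerivation.liftKaehlerDifferential (KaehlerDifferential.D ℂ O a)) =
      Submodule.Quotient.mk (KaehlerDifferential.D ℂ O a)
    rw [Derivation.liftKaehlerDifferential_comp_D]
    change Submodule.Quotient.mk (KaehlerDifferential.D ℂ O (a - algebraMap ℂ O (h.eval a))) = _
    simp
  have := LinearMap.congr_fun hr w
  rwa [LinearMap.comp_apply, hw, map_zero, Submodule.mkQ_apply, eq_comm,
    Submodule.Quotient.mk_eq_zero] at this

/-- If the differentials are free, the cotangent space at the closed point has the same rank. -/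
def HasComplexResidue.cotangentBasis {n : ℕ} (b : Module.Basis (Fin n) O Ω[O⁄ℂ]) :
    Module.Basis (Fin n) ℂ (maximalIdeal O).Cotangent :=
  Module.Basis.mk (v := fun i => h.cotangentDerivation.liftKaehlerDifferential (b i))
    (by
      rw [Fintype.linearIndependent_iff]
      intro c hc i
      have h1 : h.cotangentDerivation.liftKaehlerDifferential
          (∑ i, algebraMap ℂ O (c i) • b i) = 0 := by
        simpa using hc
      have h2 := h.mem_smul_top_of_lift_eq_zero h1
      have h3 : ∀ w ∈ (maximalIdeal O • ⊤ : Submodule O Ω[O⁄ℂ]), b.repr w i ∈ maximalIdeal O := by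
        intro w hw
        induction hw using Submodule.smul_induction_on' with
        | smul r hr n hn => simpa using Ideal.mul_mem_right _ _ hr
        | add x hx y hy h h' => simpa using add_mem h h'
      have h4 := h3 _ h2
      rw [← h.eval_eq_zero_iff, b.repr_sum_self fun i => algebraMap ℂ O (c i)] at h4
      simpa using h4)
    (by
      intro x _
      obtain ⟨a, rfl⟩ := (maximalIdeal O).toCotangent_surjective x
      rw [← h.cotangentDerivation_apply, ← Derivation.liftKaehlerDifferential_comp_D,
        ← b.sum_repr (KaehlerDifferential.D ℂ O a), map_sum]
      refine sum_mem fun i _ => ?_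
      rw [map_smul, h.smul_cotangent]
      exact Submodule.smul_mem _ _ (Submodule.subset_span ⟨i, rfl⟩))

/-- By Nakayama it suffices to work modulo `𝔪Ω`. Subtracting a constant puts `a` in `𝔪`, and then
`d(r tᵢ) = r dtᵢ + tᵢ dr` with `tᵢ dr ∈ 𝔪Ω`. -/
theorem HasComplexResidue.span_D_eq_top [Module.Finite O Ω[O⁄ℂ]] {ι : Type*} {t : ι → O}
    (ht : Ideal.span (Set.range t) = maximalIdeal O) :
    Submodule.span O (Set.range fun i => KaehlerDifferential.D ℂ O (t i)) = ⊤ := by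
  rw [eq_top_iff]
  refine Submodule.le_of_le_smul_of_le_jacobson_bot (I := maximalIdeal O) Module.Finite.fg_top
    (maximalIdeal_le_jacobson _) ?_
  rw [← KaehlerDifferential.span_range_derivation, Submodule.span_le,
    KaehlerDifferential.span_range_derivation]
  rintro _ ⟨a, rfl⟩
  have h1 := h.sub_eval_mem a
  have h2 : KaehlerDifferential.D ℂ O a =
      KaehlerDifferential.D ℂ O (a - algebraMap ℂ O (h.eval a)) := by simp
  rw [h2, SetLike.mem_coe]
  generalize a - algebraMap ℂ O (h.eval a) = x at h1
  rw [← ht] at h1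
  induction h1 using Submodule.closure_induction with
  | zero => simp
  | add x y _ _ hx hy => rw [map_add]; exact add_mem hx hy
  | smul_mem r x hx =>
    obtain ⟨i, rfl⟩ := hx
    rw [smul_eq_mul, Derivation.leibniz]
    refine add_mem (Submodule.mem_sup_left (Submodule.smul_mem _ _ (Submodule.subset_span ⟨i, rfl⟩)))
      (Submodule.mem_sup_right (Submodule.smul_mem_smul ?_ trivial))
    rw [← ht]
    exact Ideal.subset_span ⟨i, rfl⟩

omit h in
theorem D_mem_span_range {K : Type} [Field K] [Algebra ℂ K] [Algebra O K] [IsScalarTower ℂ O K]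
    {ι : Type*} {t : ι → O}
    (ht : Submodule.span O (Set.range fun i => KaehlerDifferential.D ℂ O (t i)) = ⊤)
    {a : K} (ha : a ∈ (algebraMap O K).range) :
    KaehlerDifferential.D ℂ K a ∈ Submodule.span (algebraMap O K).range
      (Set.range fun i => KaehlerDifferential.D ℂ K (algebraMap O K (t i))) := by
  obtain ⟨a, rfl⟩ := ha
  have h1 : KaehlerDifferential.D ℂ O a ∈
      Submodule.span O (Set.range fun i => KaehlerDifferential.D ℂ O (t i)) := by
    rw [ht]; trivial
  rw [← KaehlerDifferential.map_D ℂ ℂ O K]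
  generalize KaehlerDifferential.D ℂ O a = w at h1
  induction h1 using Submodule.span_induction with
  | mem x hx =>
    obtain ⟨i, rfl⟩ := hx
    refine Submodule.subset_span ⟨i, ?_⟩
    simp [KaehlerDifferential.map_D]
  | zero => simp
  | add x y _ _ hx hy => rw [map_add]; exact add_mem hx hy
  | smul r x _ hx =>
    rw [map_smul, ← algebraMap_smul K r]
    exact Submodule.smul_mem _ (⟨_, r, rfl⟩ : (algebraMap O K).range) hx

end ResidueField

/-! ### Regular local rings of dimension two -/

section DimTwo

variable {O : Type} [CommRing O] [IsLocalRing O] [IsNoetherianRing O]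

/-- Let `P` be a minimal prime over `(s)`. It has height at most one by Krull, so `t ∉ P`. If `as +
bt ∈ P`, then `b ∈ P`; hence `P ⊆ (s) + 𝔪P`, and Nakayama gives `P = (s)`. -/
theorem isPrime_span_singleton {s t : O} (hst : Ideal.span {s, t} = maximalIdeal O)
    (hdim : 1 < ringKrullDim O) : (Ideal.span {s}).IsPrime := by
  have hs : s ∈ maximalIdeal O := hst ▸ Ideal.subset_span (by simp)
  have ht : t ∈ maximalIdeal O := hst ▸ Ideal.subset_span (by simp)
  obtain ⟨P, hP, -⟩ := Ideal.exists_minimalPrimes_le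
    ((Ideal.span_singleton_le_iff_mem (maximalIdeal O)).mpr hs)
  have := hP.1.1
  have hsP : Ideal.span {s} ≤ P := hP.1.2
  have hht := Ideal.height_le_one_of_isPrincipal_of_mem_minimalPrimes _ P hP
  have htP : t ∉ P := fun htP => by
    have : maximalIdeal O ≤ P := by
      rw [← hst, Ideal.span_le]
      rintro x (rfl | rfl)
      exacts [hsP (Ideal.mem_span_singleton_self _), htP]
    have h1 := (Ideal.height_mono this).trans hht
    rw [← maximalIdeal_height_eq_ringKrullDim] at hdim
    exact absurd (WithBot.coe_le_coe.mpr h1) hdim.not_ge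
  have hle : P ≤ Ideal.span {s} := by
    refine Submodule.le_of_le_smul_of_le_jacobson_bot (I := maximalIdeal O) (IsNoetherian.noetherian P)
      (maximalIdeal_le_jacobson _) fun p hp => ?_
    have hpm : p ∈ Ideal.span {s, t} := hst ▸ le_maximalIdeal this.ne_top hp
    obtain ⟨a, b, rfl⟩ := Ideal.mem_span_pair.mp hpm
    have hbt : b * t ∈ P :=
      (Ideal.add_mem_iff_right _ (P.mul_mem_left a (hsP (Ideal.mem_span_singleton_self _)))).mp hp
    have hb : b ∈ P := (this.mem_or_mem hbt).resolve_right htP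
    refine add_mem (Submodule.mem_sup_left ?_) (Submodule.mem_sup_right ?_)
    · exact Ideal.mul_mem_left _ _ (Ideal.mem_span_singleton_self _)
    · rw [mul_comm]
      exact Submodule.smul_mem_smul ht hb
  rwa [← le_antisymm hle hsP]

/-- Otherwise `𝔪` would be principal, hence of height at most one by Krull. -/
theorem not_dvd_of_span_pair {s t : O} (hst : Ideal.span {s, t} = maximalIdeal O)
    (hdim : 1 < ringKrullDim O) : ¬ s ∣ t := fun hdvd => by
  have h1 : maximalIdeal O = Ideal.span {s} := by
    rw [← hst]
    refine le_antisymm ?_ (Ideal.span_mono (by simp))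
    rw [Ideal.span_le]
    rintro x (rfl | rfl)
    exacts [Ideal.mem_span_singleton_self _, Ideal.mem_span_singleton.mpr hdvd]
  have h2 := Ideal.height_le_one_of_isPrincipal_of_mem_minimalPrimes (Ideal.span {s})
    (maximalIdeal O) (by rw [← h1, Ideal.minimalPrimes_eq_subsingleton_self]; rfl)
  rw [← maximalIdeal_height_eq_ringKrullDim] at hdim
  exact absurd (WithBot.coe_le_coe.mpr h2) hdim.not_ge

/-- Functions on a regular surface extend over points of codimension two. -/
theorem dvd_of_forall_height_one [IsDomain O] {s t : O}
    (hst : Ideal.span {s, t} = maximalIdeal O) (hdim : ringKrullDim O = 2) {p q : O} (hq : q ≠ 0)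
    (h : ∀ P : Ideal O, P.IsPrime → P.height = 1 → ∃ r ∉ P, q ∣ r * p) : q ∣ p := by
  have hdim' : 1 < ringKrullDim O := by rw [hdim]; exact_mod_cast one_lt_two
  by_contra hqp
  have hx : (Ideal.Quotient.mk (Ideal.span {q}) p) ≠ 0 := by
    rwa [Ne, Ideal.Quotient.eq_zero_iff_mem, Ideal.mem_span_singleton]
  -- If `q ∤ p`, the annihilator of `p` in `O / (q)` lies in an associated prime `P`. Depth two
  -- excludes `P = 𝔪`; any other `P` has height one, and the hypothesis yields an annihilator of `p`
  -- outside `P`.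
  obtain ⟨P, hP, hle⟩ := exists_le_isAssociatedPrime_of_isNoetherianRing O _ hx
  rw [isAssociatedPrime_iff] at hP
  obtain ⟨hPp, y, hy⟩ := hP
  obtain ⟨y, rfl⟩ := Ideal.Quotient.mk_surjective y
  have mem_iff (a z : O) : a ∈ (⊥ : Submodule O (O ⧸ Ideal.span {q})).colon
      {Ideal.Quotient.mk (Ideal.span {q}) z} ↔ q ∣ a * z := by
    rw [Submodule.mem_colon_singleton, Submodule.mem_bot, ← Ideal.mem_span_singleton,
      ← Ideal.Quotient.eq_zero_iff_mem, map_mul]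
    rfl
  by_cases hPm : P = maximalIdeal O
  · have hs : q ∣ s * y := by
      rw [← mem_iff, ← hy, hPm, ← hst]; exact Ideal.subset_span (by simp)
    have ht : q ∣ t * y := by
      rw [← mem_iff, ← hy, hPm, ← hst]; exact Ideal.subset_span (by simp)
    have hy' : ¬ q ∣ y := fun hd => hPp.ne_top <| by
      rw [Ideal.eq_top_iff_one, hy, mem_iff, one_mul]
      exact hd
    obtain ⟨a, ha⟩ := hs
    obtain ⟨b, hb⟩ := ht
    have hs0 : s ≠ 0 := fun h0 => by
      exact not_dvd_of_span_pair (s := t) (t := s) (by rwa [Set.pair_comm]) hdim' (by simp [h0])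
    have hsp : Prime s :=
      (Ideal.span_singleton_prime hs0).mp (isPrime_span_singleton hst hdim')
    -- From `sy = qa` and `ty = qb`. As `s` is prime and does not divide `t`, it divides `a`, and
    -- cancelling `s` gives `q ∣ y`.
    have e : t * a = s * b := mul_left_cancel₀ hq (by linear_combination s * hb - t * ha)
    have hsa : s ∣ a :=
      (hsp.dvd_or_dvd (Dvd.intro _ e.symm)).resolve_left (not_dvd_of_span_pair hst hdim')
    obtain ⟨a', rfl⟩ := hsa
    exact hy' ⟨a', mul_left_cancel₀ hs0 (by linear_combination ha)⟩
  · have hlt : P < maximalIdeal O := lt_of_le_of_ne (le_maximalIdeal hPp.ne_top) hPm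
    have hm : (maximalIdeal O).height = 2 := by
      have := maximalIdeal_height_eq_ringKrullDim (R := O)
      rw [hdim] at this
      exact WithBot.coe_injective this
    have h1 : P.height + 1 ≤ 2 := hm ▸ Ideal.height_add_one_le_of_lt_of_isPrime hlt
    have h2 : P.height ≠ 0 := by
      rw [Ne, Ideal.height_eq_zero_iff_eq_bot]
      rintro rfl
      apply hq
      rw [← Ideal.mem_bot, hy, mem_iff]
      exact dvd_mul_right _ _
    have h3 : P.height = 1 := by
      refine le_antisymm ?_ (Order.one_le_iff_ne_zero.mpr h2)
      rw [← one_add_one_eq_two] at h1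
      exact (ENat.add_le_add_iff_right ENat.one_ne_top).mp h1
    obtain ⟨r, hr, hd⟩ := h P hPp h3
    exact hr (hle ((mem_iff r p).mpr hd))

end DimTwo

/-! ### Linearization of automorphisms of finite order -/

section FiniteOrder

variable {O : Type} [CommRing O] [IsLocalRing O] [Algebra ℂ O]

/-- Triviality on `𝔪 / 𝔪²` propagates to every `𝔪^(k+1) / 𝔪^(k+2)`, since these are spanned by
products. -/
theorem sub_self_mem_pow_succ {φ : O →ₐ[ℂ] O}
    (hφ : ∀ a ∈ maximalIdeal O, φ a - a ∈ maximalIdeal O ^ 2) (k : ℕ) {a : O}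
    (ha : a ∈ maximalIdeal O ^ (k + 1)) : φ a - a ∈ maximalIdeal O ^ (k + 2) := by
  induction k generalizing a with
  | zero => exact hφ a (by simpa using ha)
  | succ k ih =>
    rw [pow_succ'] at ha
    induction ha using Submodule.mul_induction_on' with
    | mem_mul_mem x hx y hy =>
      have e : φ (x * y) - x * y = φ x * (φ y - y) + (φ x - x) * y := by
        rw [map_mul]; ring
      have hφx : φ x ∈ maximalIdeal O := by
        simpa using add_mem (Ideal.pow_le_self two_ne_zero (hφ x hx)) hx
      rw [e]
      refine add_mem ?_ ?_
      · rw [show k + 1 + 2 = (k + 2) + 1 by ring, pow_succ']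
        exact Ideal.mul_mem_mul hφx (ih hy)
      · rw [show k + 1 + 2 = 2 + (k + 1) by ring, pow_add]
        exact Ideal.mul_mem_mul (hφ x hx) hy
    | add x _ y _ hx hy =>
      rw [map_add, add_sub_add_comm]
      exact add_mem hx hy

/-- An automorphism of finite order that is trivial on the cotangent space is trivial. -/
theorem eq_of_trivial_on_cotangent [IsNoetherianRing O] (h : HasComplexResidue O)
    {φ : O →ₐ[ℂ] O} (hφ : ∀ a ∈ maximalIdeal O, φ a - a ∈ maximalIdeal O ^ 2) {n : ℕ}
    (hn : n ≠ 0) (hfin : ∀ a, φ^[n] a = a) (a : O) : φ a = a := by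
  have key (k : ℕ) : ∀ a, φ a - a ∈ maximalIdeal O ^ (k + 1) := by
    induction k with
    | zero =>
      intro a
      have h1 := hφ _ (h.sub_eval_mem a)
      have h2 : φ (a - algebraMap ℂ O (h.eval a)) - (a - algebraMap ℂ O (h.eval a)) = φ a - a := by
        simp
      rw [h2] at h1
      simpa using Ideal.pow_le_self two_ne_zero h1
    | succ k ih =>
      intro a
      -- Modulo `𝔪^(k+2)` the displacement `φ a - a` is fixed by `φ`, so iterates grow linearly. At
      -- `j = n` this gives `n (φ a - a) ∈ 𝔪^(k+2)`, and `n` is invertible; Krull's intersection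
      -- theorem then concludes.
      have h1 (j : ℕ) : φ^[j] a - a - j * (φ a - a) ∈ maximalIdeal O ^ (k + 2) := by
        induction j with
        | zero => simp
        | succ j hj =>
          have e : φ^[j + 1] a - a - ((j + 1 : ℕ) : O) * (φ a - a) =
              φ (φ^[j] a - a - j * (φ a - a)) - (φ^[j] a - a - j * (φ a - a)) +
                (φ^[j] a - a - j * (φ a - a)) + j * (φ (φ a - a) - (φ a - a)) := by
            rw [Function.iterate_succ_apply']
            simp only [map_sub, map_mul, map_natCast]
            push_cast
            ring
          rw [e]
          refine add_mem (add_mem ?_ hj) (Ideal.mul_mem_left _ _ (sub_self_mem_pow_succ hφ k (ih a)))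
          exact Ideal.pow_le_pow_right (by lia) (sub_self_mem_pow_succ hφ (k + 1) hj)
      have h2 := h1 n
      rw [hfin, sub_self, zero_sub, ← neg_mul] at h2
      have hu : IsUnit (-(n : O)) := by
        rw [IsUnit.neg_iff, ← map_natCast (algebraMap ℂ O)]
        exact (IsUnit.mk0 (n : ℂ) (by exact_mod_cast hn)).map _
      exact (Ideal.unit_mul_mem_iff_mem _ hu).mp h2
  have h1 : φ a - a ∈ (⨅ k : ℕ, maximalIdeal O ^ k : Ideal O) := by
    rw [Submodule.mem_iInf]
    intro k
    exact Ideal.pow_le_pow_right (Nat.le_succ k) (key k a)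
  rw [Ideal.iInf_pow_eq_bot_of_isLocalRing _ (maximalIdeal.isMaximal O).ne_top] at h1
  exact sub_eq_zero.mp h1

end FiniteOrder

/-! ### Diagonal actions of finite groups -/

section Diagonal

variable {H : Type*} [Group H] {V : Type*} [AddCommGroup V] [Module ℂ V]

/-- Every operator is a root of the separable polynomial `X ^ |H| - 1`, hence semisimple. Since the
operators commute, common eigenvectors span, and a basis is extracted from them. -/
theorem exists_basis_of_commute [Finite H] {n : ℕ} (b : Module.Basis (Fin n) ℂ V)
    (T : H →* Module.End ℂ V) (hT : ∀ g h : H, g * h = h * g) :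
    ∃ b : Module.Basis (Fin n) ℂ V, ∀ h i, ∃ c : ℂ, T h (b i) = c • b i := by
  have : Module.Finite ℂ V := Module.Finite.of_basis b
  have hs (h : H) : (T h).IsSemisimple := by
    have hcard : (Nat.card H : ℂ) ≠ 0 := by exact_mod_cast Nat.card_pos.ne'
    refine Module.End.isSemisimple_of_squarefree_aeval_eq_zero
      (p := Polynomial.X ^ Nat.card H - 1) ?_ ?_
    · exact ((Polynomial.X_pow_sub_one_separable_iff).mpr hcard).squarefree
    · rw [map_sub, map_pow, Polynomial.aeval_X, ← map_pow, pow_card_eq_one', map_one, map_one,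
        sub_self]
  have h1 := Module.End.iSup_iInf_maxGenEigenspace_eq_top_of_iSup_maxGenEigenspace_eq_top_of_commute
    T (fun g h _ => by
      change T g * T h = T h * T g
      rw [← map_mul, hT, map_mul]) fun h => Module.End.iSup_maxGenEigenspace_eq_top _
  let S : Set V := {v | ∀ h, ∃ c : ℂ, T h v = c • v}
  have hS : ⊤ ≤ Submodule.span ℂ S := by
    rw [← h1]
    refine iSup_le fun χ v hv => Submodule.subset_span fun h => ⟨χ h, ?_⟩
    have := (Submodule.mem_iInf _).mp hv h
    rw [(hs h).isFinitelySemisimple.maxGenEigenspace_eq_eigenspace] at this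
    exact Module.End.mem_eigenspace_iff.mp this
  let b' := Module.Basis.ofSpan hS
  refine ⟨b'.reindex (b'.indexEquiv b), fun h i => ?_⟩
  rw [Module.Basis.reindex_apply]
  exact Module.Basis.ofSpan_subset hS ⟨_, rfl⟩ h

/-- Finite subgroups of `ℂˣ` are cyclic: this applies to the image of `χ₁` and to its kernel, on
which `χ₂` is injective. A lift of one generator together with the other generates `H`. -/
theorem rank_le_two_of_characters [Finite H] (χ₁ χ₂ : H →* ℂ)
    (hinj : ∀ h, χ₁ h = 1 → χ₂ h = 1 → h = 1) : Group.rank H ≤ 2 := by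
  classical
  have : Finite χ₁.toHomUnits.range :=
    Finite.of_surjective _ χ₁.toHomUnits.rangeRestrict_surjective
  have h1 : IsCyclic χ₁.toHomUnits.range :=
    isCyclic_of_injective_ringHom ((Units.coeHom ℂ).comp χ₁.toHomUnits.range.subtype)
      (Units.val_injective.comp Subtype.val_injective)
  have h2 : IsCyclic χ₁.toHomUnits.ker := by
    refine isCyclic_of_injective_ringHom (χ₂.comp χ₁.toHomUnits.ker.subtype) ?_
    rw [injective_iff_map_eq_one]
    rintro ⟨h, hh⟩ hh'
    exact Subtype.ext (hinj h (congrArg Units.val (χ₁.toHomUnits.mem_ker.mp hh)) hh')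
  obtain ⟨⟨_, g, rfl⟩, hg⟩ := h1.exists_generator
  obtain ⟨⟨k, hk⟩, hk'⟩ := h2.exists_generator
  have htop : Subgroup.closure (({g, k} : Finset H) : Set H) = ⊤ := by
    rw [Subgroup.eq_top_iff']
    intro x
    obtain ⟨m, hm⟩ := Subgroup.mem_zpowers_iff.mp (hg ⟨_, x, rfl⟩)
    have hm' : χ₁.toHomUnits g ^ m = χ₁.toHomUnits x := congrArg Subtype.val hm
    have hx : (g ^ m)⁻¹ * x ∈ χ₁.toHomUnits.ker := by
      rw [MonoidHom.mem_ker, map_mul, map_inv, map_zpow, hm', inv_mul_cancel]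
    obtain ⟨l, hl⟩ := Subgroup.mem_zpowers_iff.mp (hk' ⟨_, hx⟩)
    have hl' : k ^ l = (g ^ m)⁻¹ * x := congrArg Subtype.val hl
    have hx' : x = g ^ m * k ^ l := by rw [hl', mul_inv_cancel_left]
    rw [hx']
    exact mul_mem (zpow_mem (Subgroup.subset_closure (by simp)) _)
      (zpow_mem (Subgroup.subset_closure (by simp)) _)
  exact (Group.rank_le htop).trans Finset.card_le_two

/-- The two eigenvalues are characters that jointly separate elements, and characters kill
commutators. -/
theorem commute_and_rank_le_two_of_diagonal [Finite H] (T : H →* Module.End ℂ V)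
    (hT : ∀ h, T h = LinearMap.id → h = 1) (b : Module.Basis (Fin 2) ℂ V)
    (hb : ∀ h i, ∃ c : ℂ, T h (b i) = c • b i) :
    (∀ g h : H, g * h = h * g) ∧ Group.rank H ≤ 2 := by
  choose c hc using hb
  have hc_eq {h i z} (e : T h (b i) = z • b i) : c h i = z := by
    rw [hc] at e
    exact smul_left_injective ℂ (b.ne_zero i) e
  let χ (i : Fin 2) : H →* ℂ :=
    { toFun h := c h i
      map_one' := hc_eq (by simp)
      map_mul' g h := hc_eq (by simp [hc, smul_smul, mul_comm]) }
  have hinj (h : H) (h0 : χ 0 h = 1) (h1 : χ 1 h = 1) : h = 1 := by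
    refine hT h (b.ext fun i => ?_)
    rw [hc]
    fin_cases i
    · exact (congrArg (· • b 0) h0).trans (one_smul _ _)
    · exact (congrArg (· • b 1) h1).trans (one_smul _ _)
  refine ⟨fun g h => ?_, rank_le_two_of_characters (χ 0) (χ 1) hinj⟩
  have h1 (i : Fin 2) : χ i (g * h * (h * g)⁻¹) = 1 := by
    have e : χ i (g * h) = χ i (h * g) := by rw [map_mul, map_mul, mul_comm]
    rw [map_mul, e, ← map_mul, mul_inv_cancel, map_one]
  exact mul_inv_eq_one.mp (hinj _ (h1 0) (h1 1))

end Diagonal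

/-! ### Pullback of germs -/

theorem stalkSpecializes_comp_stalkMap_comp {X Y Z : Scheme} (f : X ⟶ Y) (g : Y ⟶ Z) {x : X} {y : Y}
    {z : Z} (hf : f x ⤳ y) (hg : g y ⤳ z) (h : (f ≫ g) x ⤳ z) :
    Z.presheaf.stalkSpecializes h ≫ (f ≫ g).stalkMap x =
      (Z.presheaf.stalkSpecializes hg ≫ g.stalkMap y) ≫
        Y.presheaf.stalkSpecializes hf ≫ f.stalkMap x := by
  rw [Scheme.Hom.stalkMap_comp, Category.assoc, ← Scheme.Hom.stalkSpecializes_stalkMap_assoc,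
    TopCat.Presheaf.stalkSpecializes_comp_assoc]
  rfl

theorem pullbackGerm_comp {X Y Z : CScheme} (f : X ⟶ Y) (g : Y ⟶ Z) {x : X.left} {y : Y.left}
    {z : Z.left} (hf : f.left x ⤳ y) (hg : g.left y ⤳ z) (h : (f ≫ g).left x ⤳ z) :
    pullbackGerm (f ≫ g) x z h = (pullbackGerm f x y hf).comp (pullbackGerm g y z hg) := by
  ext a
  exact congrArg (fun φ => φ.hom a) (stalkSpecializes_comp_stalkMap_comp f.left g.left hf hg h)

theorem pullbackGerm_eq_id {X : CScheme} {g : X ⟶ X} (hg : g = 𝟙 X) {x : X.left}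
    (h : g.left x ⤳ x) : pullbackGerm g x x h = AlgHom.id ℂ _ := by
  subst hg
  ext a
  have e : X.left.presheaf.stalkSpecializes (specializes_rfl (x := x)) ≫
      (𝟙 X.left : X.left ⟶ X.left).stalkMap x = 𝟙 _ := by
    rw [Scheme.Hom.stalkMap_id, TopCat.Presheaf.stalkSpecializes_refl]
    exact Category.id_comp _
  exact congrArg (fun φ => φ.hom a) e

theorem SpecMap_pullbackGerm_fromSpecStalk {X Y : CScheme} (f : Y ⟶ X) {y : Y.left} {x : X.left}
    (h : f.left y ⤳ x) :
    Spec.map (CommRingCat.ofHom (pullbackGerm f y x h).toRingHom) ≫ X.left.fromSpecStalk x =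
      Y.left.fromSpecStalk y ≫ f.left := by
  have e : CommRingCat.ofHom (pullbackGerm f y x h).toRingHom =
    X.left.presheaf.stalkSpecializes h ≫ f.left.stalkMap y := rfl
  rw [e, Spec.map_comp, Category.assoc, Scheme.SpecMap_stalkSpecializes_fromSpecStalk,
    Scheme.SpecMap_stalkMap_fromSpecStalk]

instance isDominant_fromSpecStalk (X : Scheme) [IsIntegral X] (x : X) :
    IsDominant (X.fromSpecStalk x) := by
  refine ⟨fun z => ?_⟩
  have h1 : genericPoint X ∈ Set.range (X.fromSpecStalk x) := by
    rw [Scheme.range_fromSpecStalk]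
    exact genericPoint_specializes x
  have h2 := (genericPoint_spec X).specializes (Set.mem_univ z)
  exact closure_mono (Set.singleton_subset_iff.mpr h1) h2.mem_closure

/-- An endomorphism that is trivial on one local ring is trivial. -/
theorem eq_id_of_pullbackGerm_eq_id {X : CScheme} [IsIntegral X.left] [IsSeparated X.hom]
    (g : X ⟶ X) {x : X.left} (h : g.left x ⤳ x) (hg : pullbackGerm g x x h = AlgHom.id ℂ _) :
    g = 𝟙 X := by
  apply CategoryTheory.Over.OverMorphism.ext
  refine ext_of_isDominant_of_isSeparated X.hom (by simp) (X.left.fromSpecStalk x) ?_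
  rw [← SpecMap_pullbackGerm_fromSpecStalk g h, hg, Over.id_left, Category.comp_id]
  have e : CommRingCat.ofHom (AlgHom.id ℂ (X.left.presheaf.stalk x)).toRingHom = 𝟙 _ := rfl
  rw [e, Spec.map_id, Category.id_comp]

/-! ### Tangent representations -/

section Tangent

variable {H : Type*} [Group H] {X : CScheme} (σ : H →* Aut X) {x : X.left}
  (hx : ∀ h, (σ h).hom.left x = x)

/-- The pullback action on the local ring at a fixed point. -/
def germAction (h : H) : X.left.presheaf.stalk x →ₐ[ℂ] X.left.presheaf.stalk x :=
  pullbackGerm (σ h).hom x x (specializes_of_eq (hx h))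

theorem germAction_one : germAction σ hx 1 = AlgHom.id ℂ _ :=
  pullbackGerm_eq_id (by rw [map_one]; rfl) _

/-- Pullback reverses products; dualizing the cotangent space reverses them again, so
`tangentAction` is a homomorphism. -/
theorem germAction_mul (g h : H) :
    germAction σ hx (g * h) = (germAction σ hx h).comp (germAction σ hx g) := by
  have e : (σ (g * h)).hom = (σ h).hom ≫ (σ g).hom := by rw [map_mul]; rfl
  have e' : ((σ h).hom ≫ (σ g).hom).left x ⤳ x := by
    rw [← e]; exact specializes_of_eq (hx _)
  have : germAction σ hx (g * h) = pullbackGerm ((σ h).hom ≫ (σ g).hom) x x e' := by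
    simp only [germAction, e]
  rw [this]
  exact pullbackGerm_comp _ _ _ _ _

theorem germAction_iterate (h : H) (n : ℕ) (a) :
    (germAction σ hx h)^[n] a = germAction σ hx (h ^ n) a := by
  induction n with
  | zero => rw [pow_zero, germAction_one]; rfl
  | succ n ih => rw [Function.iterate_succ_apply', ih, pow_succ, germAction_mul]; rfl

theorem germAction_mem (h : H) {a} (ha : a ∈ maximalIdeal (X.left.presheaf.stalk x)) :
    germAction σ hx h a ∈ maximalIdeal (X.left.presheaf.stalk x) :=
  maximalIdeal_le_comap_pullbackGerm (σ h).hom x (hx h) ha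

theorem tangentMap_apply_toCotangent (h : H) (v : TangentSpace X x)
    (a : maximalIdeal (X.left.presheaf.stalk x)) :
    tangentMap (σ h).hom x (hx h) v (Ideal.toCotangent _ a) =
      v (Ideal.toCotangent _ ⟨germAction σ hx h a, germAction_mem σ hx h a.2⟩) := rfl

/-- The action on the tangent space at a fixed point. -/
def tangentAction : H →* Module.End ℂ (TangentSpace X x) where
  toFun h := tangentMap (σ h).hom x (hx h)
  map_one' := by
    ext v w
    obtain ⟨a, rfl⟩ := Ideal.toCotangent_surjective _ w
    rw [tangentMap_apply_toCotangent]
    simp only [germAction_one]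
    rfl
  map_mul' g h := by
    ext v w
    obtain ⟨a, rfl⟩ := Ideal.toCotangent_surjective _ w
    rw [tangentMap_apply_toCotangent]
    simp only [germAction_mul]
    rfl

/-- Finite order propagates triviality from the cotangent space to the local ring, and separatedness
from there to `X`. -/
theorem eq_one_of_tangentMap_eq_id [Finite H] [IsIntegral X.left] [IsSeparated X.hom]
    [IsNoetherianRing (X.left.presheaf.stalk x)]
    (hres : HasComplexResidue (X.left.presheaf.stalk x))
    (hσ : ∀ h, (σ h).hom = 𝟙 X → h = 1) (h : H)
    (ht : tangentMap (σ h).hom x (hx h) = LinearMap.id) : h = 1 := by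
  apply hσ
  refine eq_id_of_pullbackGerm_eq_id _ (specializes_of_eq (hx h)) (AlgHom.ext fun a => ?_)
  refine eq_of_trivial_on_cotangent hres (fun a ha => ?_) (Nat.card_pos (α := H)).ne'
    (fun a => ?_) a
  · have h1 : Ideal.toCotangent _ ⟨germAction σ hx h a, germAction_mem σ hx h ha⟩ =
        Ideal.toCotangent _ ⟨a, ha⟩ := by
      rw [← sub_eq_zero, ← Module.forall_dual_apply_eq_zero_iff ℂ]
      intro v
      rw [map_sub, ← tangentMap_apply_toCotangent σ hx h v ⟨a, ha⟩, ht, LinearMap.id_apply,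
        sub_self]
    exact (Ideal.toCotangent_eq _).mp h1
  · exact (germAction_iterate σ hx h _ a).trans (by rw [pow_card_eq_one', germAction_one]; rfl)

/-- Meant for `f(y)`, where no invariant pair of transversal curves is available and diagonality
must come from commutativity. -/
theorem actsFaithfullyAndDiagonallyAt_of_commute [Finite H] [IsIntegral X.left]
    [IsSeparated X.hom] [IsNoetherianRing (X.left.presheaf.stalk x)]
    (hres : HasComplexResidue (X.left.presheaf.stalk x))
    (b : Module.Basis (Fin 2) ℂ (maximalIdeal (X.left.presheaf.stalk x)).Cotangent)
    (hσ : ∀ h, (σ h).hom = 𝟙 X → h = 1) (hcomm : ∀ g h : H, g * h = h * g) (hx : ∀ h, (σ h).hom.left x = x) :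
    ActsFaithfullyAndDiagonallyAt σ x :=
  ⟨hx, eq_one_of_tangentMap_eq_id σ hx hres hσ,
    exists_basis_of_commute b.dualBasis (tangentAction σ hx) hcomm⟩

/-- The tangent representation is diagonal if the action preserves the ideals generated by
the members of a regular system of parameters. -/
theorem exists_diagonal_basis (hres : HasComplexResidue (X.left.presheaf.stalk x))
    (b : Module.Basis (Fin 2) ℂ (maximalIdeal (X.left.presheaf.stalk x)).Cotangent)
    (t : Fin 2 → maximalIdeal (X.left.presheaf.stalk x))
    (hb : ∀ i, b i = Ideal.toCotangent _ (t i))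
    (ht : ∀ h i, (t i : X.left.presheaf.stalk x) ∣ germAction σ hx h (t i)) :
    ∃ b : Module.Basis (Fin 2) ℂ (TangentSpace X x), ∀ h i, ∃ c : ℂ,
      tangentMap (σ h).hom x (hx h) (b i) = c • b i := by
  refine ⟨b.dualBasis, fun h i => ?_⟩
  choose u hu using ht h
  -- The eigenvalue is the value at the point of the factor `u i` by which pullback multiplies `t
  -- i`.
  refine ⟨hres.eval (u i), b.ext fun j => ?_⟩
  have e : Ideal.toCotangent _ ⟨germAction σ hx h (t j), germAction_mem σ hx h (t j).2⟩ =
      hres.eval (u j) • Ideal.toCotangent _ (t j) := by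
    rw [← hres.smul_cotangent, ← map_smul]
    congr 1
    ext
    exact (hu j).trans (mul_comm _ _)
  rw [hb j, tangentMap_apply_toCotangent, e, ← hb j, map_smul, LinearMap.smul_apply,
    Module.Basis.dualBasis_apply_self]
  split_ifs with hij
  · rw [hij]
  · simp

end Tangent

/-! ### Local rings of smooth surfaces -/

/-- Near `x` there is a standard smooth affine chart, whose differentials are free of rank two. The
stalk is a localization of its coordinate ring, and differentials commute with localization. -/
theorem essFiniteType_and_basis_of_smooth (X : CScheme) [SmoothOfRelativeDimension 2 X.hom]
    (x : X.left) : Algebra.EssFiniteType ℂ (X.left.presheaf.stalk x) ∧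
      Nonempty (Module.Basis (Fin 2) (X.left.presheaf.stalk x)
        Ω[X.left.presheaf.stalk x⁄ℂ]) := by
  obtain ⟨U, hU, V, hV, hxV, e, hst⟩ :=
    SmoothOfRelativeDimension.exists_isStandardSmoothOfRelativeDimension (n := 2) (f := X.hom) x
  obtain rfl : U = ⊤ := by
    have : Subsingleton (Spec (CommRingCat.of ℂ)) :=
      inferInstanceAs (Subsingleton (PrimeSpectrum ℂ))
    ext z
    simp only [TopologicalSpace.Opens.coe_top, Set.mem_univ, iff_true]
    exact Subsingleton.elim (X.hom x) z ▸ e hxV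
  let φ : CommRingCat.of ℂ ⟶ Γ(X.left, V) :=
    (Scheme.ΓSpecIso (CommRingCat.of ℂ)).inv ≫ X.hom.appLE ⊤ V e
  let : Algebra ℂ Γ(X.left, V) := φ.hom.toAlgebra
  have hsm : Algebra.IsStandardSmoothOfRelativeDimension 2 ℂ Γ(X.left, V) := by
    have h := RingHom.IsStandardSmoothOfRelativeDimension.comp hst
      (RingHom.IsStandardSmoothOfRelativeDimension.equiv
        (Scheme.ΓSpecIso (CommRingCat.of ℂ)).symm.commRingCatIsoToRingEquiv)
    exact h
  have : Algebra.IsStandardSmooth ℂ Γ(X.left, V) :=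
    Algebra.IsStandardSmoothOfRelativeDimension.isStandardSmooth 2
  let : Algebra Γ(X.left, V) (X.left.presheaf.stalk x) :=
    TopCat.Presheaf.algebra_section_stalk X.left.presheaf ⟨x, hxV⟩
  have hloc : IsLocalization.AtPrime (X.left.presheaf.stalk x) (hV.primeIdealOf ⟨x, hxV⟩).asIdeal :=
    hV.isLocalization_stalk ⟨x, hxV⟩
  have : IsScalarTower ℂ Γ(X.left, V) (X.left.presheaf.stalk x) := by
    apply IsScalarTower.of_algebraMap_eq'
    have h : stalkStructure X x = φ ≫ X.left.presheaf.germ V x hxV := by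
      simp only [stalkStructure, φ, Category.assoc]
      rw [Scheme.Hom.appLE, Category.assoc, TopCat.Presheaf.germ_res]
      rfl
    exact congrArg CommRingCat.Hom.hom h
  have : Nontrivial Γ(X.left, V) :=
    RingHom.domain_nontrivial (algebraMap Γ(X.left, V) (X.left.presheaf.stalk x))
  have hess : Algebra.EssFiniteType ℂ (X.left.presheaf.stalk x) := by
    have h1 : Algebra.EssFiniteType ℂ Γ(X.left, V) := inferInstance
    have h2 : Algebra.EssFiniteType Γ(X.left, V) (X.left.presheaf.stalk x) :=
      .of_isLocalization _ (hV.primeIdealOf ⟨x, hxV⟩).asIdeal.primeCompl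
    exact .comp ℂ Γ(X.left, V) _
  refine ⟨hess, ?_⟩
  have : Module.Finite Γ(X.left, V) Ω[Γ(X.left, V)⁄ℂ] := inferInstance
  have : Module.Free Γ(X.left, V) Ω[Γ(X.left, V)⁄ℂ] := inferInstance
  have hrank := Algebra.IsStandardSmoothOfRelativeDimension.rank_kaehlerDifferential
    (R := ℂ) (S := Γ(X.left, V)) 2
  let b := Module.finBasisOfFinrankEq Γ(X.left, V) Ω[Γ(X.left, V)⁄ℂ]
    (Module.finrank_eq_of_rank_eq hrank)
  exact ⟨b.ofIsLocalizedModule (X.left.presheaf.stalk x)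
    (hV.primeIdealOf ⟨x, hxV⟩).asIdeal.primeCompl
    (KaehlerDifferential.map ℂ ℂ Γ(X.left, V) (X.left.presheaf.stalk x))⟩

/-! ### Cotangent spaces and dimension at complex points -/

section

variable (X : CScheme) [SmoothOfRelativeDimension 2 X.hom] (x : X.left)

instance : Algebra.EssFiniteType ℂ (X.left.presheaf.stalk x) :=
  (essFiniteType_and_basis_of_smooth X x).1

theorem isNoetherianRing_stalk : IsNoetherianRing (X.left.presheaf.stalk x) :=
  Algebra.EssFiniteType.isNoetherianRing ℂ _

variable {X x} in
/-- The cotangent space of a smooth surface at a complex point has dimension two. -/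
theorem nonempty_cotangentBasis (h : HasComplexResidue (X.left.presheaf.stalk x)) :
    Nonempty (Module.Basis (Fin 2) ℂ (maximalIdeal (X.left.presheaf.stalk x)).Cotangent) :=
  (essFiniteType_and_basis_of_smooth X x).2.map h.cotangentBasis

variable {X x} in
-- The dimension is at most the number of generators of `𝔪`, and by Nakayama lifts of a basis of `𝔪
-- / 𝔪²` generate `𝔪`.
theorem ringKrullDim_stalk_le_two (h : HasComplexResidue (X.left.presheaf.stalk x)) :
    ringKrullDim (X.left.presheaf.stalk x) ≤ 2 := by
  have := isNoetherianRing_stalk X x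
  obtain ⟨b⟩ := nonempty_cotangentBasis h
  refine (ringKrullDim_le_spanFinrank_maximalIdeal _).trans ?_
  choose t ht using fun i => Ideal.toCotangent_surjective _ (b i)
  have htop : Submodule.span (ResidueField (X.left.presheaf.stalk x))
      ((maximalIdeal _).toCotangent '' Set.range t) = ⊤ := by
    rw [eq_top_iff]
    intro v _
    rw [← b.sum_repr v]
    refine sum_mem fun i _ => ?_
    rw [← algebraMap_smul (X.left.presheaf.stalk x) (b.repr v i)]
    exact Submodule.smul_of_tower_mem _ _ (Submodule.subset_span ⟨t i, ⟨i, rfl⟩, ht i⟩)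
  rw [CotangentSpace.span_image_eq_top_iff] at htop
  have h1 : maximalIdeal (X.left.presheaf.stalk x) =
      Ideal.span (Set.range fun i => (t i : X.left.presheaf.stalk x)) := by
    have h2 := congrArg (Submodule.map (maximalIdeal _).subtype) htop
    rw [Submodule.map_span, Submodule.map_top, Submodule.range_subtype, ← Set.range_comp] at h2
    exact h2.symm
  rw [h1]
  have h3 : (Submodule.span (X.left.presheaf.stalk x)
      (Set.range fun i => (t i : X.left.presheaf.stalk x))).spanFinrank ≤ 2 := by
    refine (Submodule.spanFinrank_span_le_ncard_of_finite (Set.finite_range _)).trans ?_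
    rw [← Set.image_univ]
    exact (Set.ncard_image_le Set.finite_univ).trans (by simp [Set.ncard_univ])
  exact_mod_cast h3

end

/-- A point with residue field `ℂ` is closed. -/
theorem isClosed_singleton_of_hasComplexResidue {X : CScheme} {y : X.left}
    (h : HasComplexResidue (X.left.presheaf.stalk y)) : IsClosed {y} := by
  rw [← closure_eq_iff_isClosed]
  refine Set.Subset.antisymm (fun z hz => ?_) subset_closure
  have hyz : y ⤳ z := specializes_iff_mem_closure.mpr hz
  let φ := X.left.presheaf.stalkSpecializes hyz
  have hφ (c : ℂ) : φ.hom (algebraMap ℂ _ c) = algebraMap ℂ _ c :=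
    congrArg (fun ψ => ψ.hom c) (stalkStructure_stalkSpecializes X hyz)
  -- If `a ∈ 𝔪_z` had a nonzero value `c` at `y`, then `a - c` would be a unit at `z` vanishing at
  -- `y`. A local generization map sends closed point to closed point, which gives `z = y`.
  have hlocal : IsLocalHom φ.hom := by
    refine ((local_hom_TFAE φ.hom).out 0 3).mpr fun a ha => ?_
    rw [Ideal.mem_comap, ← h.eval_eq_zero_iff]
    by_contra hc
    have h1 : IsUnit (a - algebraMap ℂ (X.left.presheaf.stalk z) (h.eval (φ.hom a))) := by
      by_contra h2
      have h3 := sub_mem ha ((mem_maximalIdeal _).mpr h2)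
      rw [sub_sub_cancel] at h3
      exact h3 ((IsUnit.mk0 _ hc).map _)
    have h2 := h1.map φ.hom
    rw [map_sub, hφ] at h2
    exact h.sub_eval_mem (φ.hom a) h2
  have h1 := X.left.SpecMap_stalkSpecializes_fromSpecStalk hyz
  have h2 : X.left.fromSpecStalk z (Spec.map φ (closedPoint (X.left.presheaf.stalk y))) =
      X.left.fromSpecStalk y (closedPoint (X.left.presheaf.stalk y)) := by
    rw [← h1]
    rfl
  have h3 : Spec.map φ (closedPoint (X.left.presheaf.stalk y)) =
      closedPoint (X.left.presheaf.stalk z) := comap_closedPoint φ.hom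
  rw [h3, Scheme.fromSpecStalk_closedPoint, Scheme.fromSpecStalk_closedPoint] at h2
  exact h2

/-! ### Birational maps and function fields -/

theorem SpecMap_stalkStructure (X : CScheme) (x : X.left) :
    Spec.map (stalkStructure X x) = X.left.fromSpecStalk x ≫ X.hom := by
  rw [stalkStructure, Spec.map_comp, Spec.map_comp, Category.assoc,
    ← Scheme.fromSpecStalk_toSpecΓ, Category.assoc, ← Scheme.toSpecΓ_naturality_assoc]
  simp

theorem stalkStructure_eq_comp_germ (X : CScheme) {U : X.left.Opens}
    {φ : CommRingCat.of ℂ ⟶ Γ(X.left, U)} (h : U.ι ≫ X.hom = U.toSpecΓ ≫ Spec.map φ)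
    {x : X.left} (hx : x ∈ U) : stalkStructure X x = φ ≫ X.left.presheaf.germ U x hx := by
  apply Spec.map_injective
  rw [SpecMap_stalkStructure, Spec.map_comp, ← Scheme.Opens.fromSpecStalkOfMem_toSpecΓ,
    Category.assoc, ← h, Scheme.Opens.fromSpecStalkOfMem_ι_assoc]

theorem pullbackGerm_bijective {X Y : CScheme} (f : Y ⟶ X) {y : Y.left} {x : X.left}
    (h : f.left y = x) [IsIso (f.left.stalkMap y)] :
    Function.Bijective (pullbackGerm f y x (specializes_of_eq h)) := by
  have h1 : IsIso (X.left.presheaf.stalkSpecializes (specializes_of_eq h)) :=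
    (X.left.presheaf.stalkCongr (.of_eq h.symm)).isIso_hom
  exact ConcreteCategory.bijective_of_isIso
    (X.left.presheaf.stalkSpecializes (specializes_of_eq h) ≫ f.left.stalkMap y)

theorem map_genericPoint {X Y : Scheme} [IrreducibleSpace X] [IrreducibleSpace Y] (f : Y ⟶ X)
    [IsDominant f] : f (genericPoint Y) = genericPoint X :=
  ((specializes_genericPoint f).antisymm (genericPoint_specializes _)).eq

theorem functionFieldMap_bijective {X Y : CScheme} [IsIntegral X.left] [IsIntegral Y.left]
    (f : Y ⟶ X) [IsDominant f.left] [IsIso (f.left.stalkMap (genericPoint Y.left))] :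
    Function.Bijective (functionFieldMap f) :=
  pullbackGerm_bijective f (map_genericPoint f.left)

theorem isIso_stalkMap_genericPoint {X Y : Scheme} [IrreducibleSpace X] [IrreducibleSpace Y]
    (f : Y ⟶ X) [IsDominant f] {U : X.Opens} (hU : Dense (U : Set X)) [IsIso (f ∣_ U)] :
    IsIso (f.stalkMap (genericPoint Y)) := by
  have hη : genericPoint Y ∈ f ⁻¹ᵁ U := by
    change f (genericPoint Y) ∈ U
    rw [map_genericPoint]
    obtain ⟨u, hu⟩ := hU.nonempty
    exact (genericPoint_specializes u).mem_open U.2 hu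
  let y : ↥(f ⁻¹ᵁ U).toScheme := ⟨genericPoint Y, hη⟩
  have h : IsIso ((f ∣_ U).stalkMap y) := inferInstance
  exact ((MorphismProperty.isomorphisms CommRingCat).arrow_mk_iso_iff
    (morphismRestrictStalkMap f U y)).mp h

theorem mapForm_id {K : Type} [Field K] [Algebra ℂ K] (η : ⋀[K]^2 Ω[K⁄ℂ]) :
    mapForm (AlgHom.id ℂ K) η = η := by
  induction η using form_induction with
  | zero => simp
  | add η θ h h' => simp [h, h']
  | smul c a b => simp [mapForm_smul_dWedge]

/-- A volume preserving birational map identifies the function fields compatibly with the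
volume forms. -/
theorem IsVolumePreserving.exists_algEquiv {X Y : CScheme} [IsIntegral X.left] [IsIntegral Y.left]
    {ωX : RationalForm X} {ωY : RationalForm Y} {φ : X.left.PartialIso Y.left}
    {hφ : φ.IsOver X.hom Y.hom} (h : IsVolumePreserving ωX ωY φ hφ) :
    ∃ ψ : Y.left.functionField ≃ₐ[ℂ] X.left.functionField, ∃ c : ℂ, c ≠ 0 ∧
      mapForm ψ.toAlgHom ωY = algebraMap ℂ X.left.functionField c • ωX := by
  let U : CScheme := Over.mk (φ.source.ι ≫ X.hom)
  let i : U ⟶ X := Over.homMk φ.source.ι rfl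
  let j : U ⟶ Y := Over.homMk (φ.iso.hom ≫ φ.target.ι) ((Category.assoc _ _ _).trans hφ)
  have : IsIntegral U.left := isIntegral_opens φ.source φ.dense_source
  have hi : IsDominant i.left := Opens.isDominant_ι φ.dense_source
  have : IsDominant φ.target.ι := Opens.isDominant_ι φ.dense_target
  have hj : IsDominant j.left := inferInstanceAs (IsDominant (φ.iso.hom ≫ φ.target.ι))
  obtain ⟨c, hc, e⟩ := h
  have : IsOpenImmersion i.left := inferInstanceAs (IsOpenImmersion φ.source.ι)
  have : IsOpenImmersion j.left := inferInstanceAs (IsOpenImmersion (φ.iso.hom ≫ φ.target.ι))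
  let θi := AlgEquiv.ofBijective _ (functionFieldMap_bijective i)
  let θj := AlgEquiv.ofBijective _ (functionFieldMap_bijective j)
  refine ⟨θj.trans θi.symm, c, hc, ?_⟩
  have e' : mapForm θj.toAlgHom ωY =
    algebraMap ℂ U.left.functionField c • mapForm θi.toAlgHom ωX := e
  have e2 : (θj.trans θi.symm).toAlgHom = θi.symm.toAlgHom.comp θj.toAlgHom := rfl
  rw [e2, ← mapForm_comp, e', mapForm_smul, mapForm_comp]
  have e3 : θi.symm.toAlgHom.comp θi.toAlgHom = AlgHom.id ℂ _ := by
    ext a; exact θi.symm_apply_apply a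
  rw [e3, mapForm_id]
  congr 1
  exact θi.symm.commutes c

/-! ### The function field of the plane -/

theorem aeval_mul_of_isHomogeneous {σ R A : Type*} [Fintype σ] [CommRing R] [CommRing A]
    [Algebra R A] {p : MvPolynomial σ R} {n : ℕ} (hp : p.IsHomogeneous n) (u : A) (g : σ → A) :
    MvPolynomial.aeval (fun i => u * g i) p = u ^ n * MvPolynomial.aeval g p := by
  rw [MvPolynomial.aeval_def, MvPolynomial.aeval_def, MvPolynomial.eval₂_eq',
    MvPolynomial.eval₂_eq', Finset.mul_sum]
  refine Finset.sum_congr rfl fun d hd => ?_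
  have e : ∑ i, d i = n := by
    have := hp (MvPolynomial.mem_support_iff.mp hd)
    rw [← this, Finsupp.weight_apply, Finsupp.sum_fintype _ _ (by simp)]
    simp
  simp_rw [mul_pow, Finset.prod_mul_distrib, Finset.prod_pow_eq_pow_sum, e]
  ring

/-- The coordinate ring of the chart `x₀ ≠ 0`. -/
abbrev ChartRing : Type :=
  HomogeneousLocalization.Away planeGrading (MvPolynomial.X 0 : MvPolynomial (Fin 3) ℂ)

theorem val_fromZeroRingHom_algebraMap (c : ℂ) :
    (HomogeneousLocalization.fromZeroRingHom planeGrading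
      (Submonoid.powers (MvPolynomial.X 0 : MvPolynomial (Fin 3) ℂ))
      (algebraMap ℂ (planeGrading 0) c)).val = algebraMap ℂ (Localization.Away
        (MvPolynomial.X 0 : MvPolynomial (Fin 3) ℂ)) c := by
  rw [IsScalarTower.algebraMap_apply ℂ (MvPolynomial (Fin 3) ℂ) (Localization.Away _),
    ← Localization.mk_one_eq_algebraMap]
  rfl

instance chartRingAlgebra : Algebra ℂ ChartRing where
  algebraMap := (HomogeneousLocalization.fromZeroRingHom planeGrading _).comp
    (algebraMap ℂ (planeGrading 0))
  commutes' _ _ := mul_comm _ _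
  smul_def' c z := by
    apply HomogeneousLocalization.val_injective
    rw [HomogeneousLocalization.val_smul, HomogeneousLocalization.val_mul, RingHom.comp_apply,
      val_fromZeroRingHom_algebraMap, Algebra.smul_def]

instance : @IsScalarTower ℂ ChartRing
    (Localization.Away (MvPolynomial.X 0 : MvPolynomial (Fin 3) ℂ))
    Algebra.toSMul Algebra.toSMul Algebra.toSMul :=
  .of_algebraMap_eq fun c => (val_fromZeroRingHom_algebraMap c).symm

/-- The affine coordinates `x₁ / x₀` and `x₂ / x₀`. -/
def chartCoordinate (i : Fin 3) : ChartRing :=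
  HomogeneousLocalization.Away.mk planeGrading (X_mem 0) 1 (MvPolynomial.X i) (by simpa using X_mem i)

theorem X_mul_chartCoordinate (i : Fin 3) :
    algebraMap (MvPolynomial (Fin 3) ℂ)
          (Localization.Away (MvPolynomial.X 0 : MvPolynomial (Fin 3) ℂ)) (MvPolynomial.X 0) *
        algebraMap ChartRing _ (chartCoordinate i) =
      algebraMap (MvPolynomial (Fin 3) ℂ) _ (MvPolynomial.X i) := by
  change _ * HomogeneousLocalization.val (chartCoordinate i) = _
  rw [chartCoordinate, HomogeneousLocalization.Away.val_mk, Localization.mk_eq_mk', mul_comm]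
  simp

/-- Dehomogenization: `p / X₀ⁿ = p(1, X₁/X₀, X₂/X₀)` for `p` homogeneous of degree `n`. -/
theorem aeval_chartCoordinate_surjective :
    Function.Surjective (MvPolynomial.aeval ![chartCoordinate 1, chartCoordinate 2] :
      MvPolynomial (Fin 2) ℂ →ₐ[ℂ] ChartRing) := by
  intro z
  obtain ⟨n, p, hp, rfl⟩ := HomogeneousLocalization.Away.mk_surjective planeGrading (X_mem 0) z
  let L := Localization.Away (MvPolynomial.X 0 : MvPolynomial (Fin 3) ℂ)
  refine ⟨MvPolynomial.aeval ![1, MvPolynomial.X 0, MvPolynomial.X 1] p, ?_⟩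
  apply HomogeneousLocalization.val_injective
  rw [HomogeneousLocalization.Away.val_mk, Localization.mk_eq_mk', eq_comm,
    IsLocalization.mk'_eq_iff_eq_mul]
  have h1 : algebraMap (MvPolynomial (Fin 3) ℂ) L p = MvPolynomial.aeval
      (fun i => algebraMap (MvPolynomial (Fin 3) ℂ) L (MvPolynomial.X 0) *
        algebraMap ChartRing L (chartCoordinate i)) p := by
    simp_rw [L, X_mul_chartCoordinate]
    have := MvPolynomial.aeval_algebraMap_apply L (MvPolynomial.X : Fin 3 → MvPolynomial (Fin 3) ℂ) p
    rw [MvPolynomial.aeval_X_left_apply] at this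
    exact this.symm
  have hp' : p.IsHomogeneous n := by simpa using hp
  have h0 : algebraMap ChartRing L (chartCoordinate 0) = 1 := by
    have hu : IsUnit (algebraMap (MvPolynomial (Fin 3) ℂ) L (MvPolynomial.X 0)) :=
      IsLocalization.Away.algebraMap_isUnit _
    have := X_mul_chartCoordinate 0
    exact hu.mul_left_cancel (this.trans (mul_one _).symm)
  rw [h1, aeval_mul_of_isHomogeneous hp', mul_comm, map_pow]
  congr 1
  change _ = IsScalarTower.toAlgHom ℂ ChartRing L _
  rw [MvPolynomial.comp_aeval_apply, MvPolynomial.aeval_eq_bind₁, MvPolynomial.aeval_bind₁]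
  congr 2
  funext i
  fin_cases i
  · simpa using h0
  · simp
  · simp

/-- Setting `X₀ = 1` extends to the localization and gives a left inverse. -/
theorem aeval_chartCoordinate_injective :
    Function.Injective (MvPolynomial.aeval ![chartCoordinate 1, chartCoordinate 2] :
      MvPolynomial (Fin 2) ℂ →ₐ[ℂ] ChartRing) := by
  let g : MvPolynomial (Fin 3) ℂ →ₐ[ℂ] MvPolynomial (Fin 2) ℂ :=
    MvPolynomial.aeval ![1, MvPolynomial.X 0, MvPolynomial.X 1]
  let L := Localization.Away (MvPolynomial.X 0 : MvPolynomial (Fin 3) ℂ)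
  have hg0 : g (MvPolynomial.X 0) = 1 := by simp [g]
  let k : L →ₐ[ℂ] MvPolynomial (Fin 2) ℂ := IsLocalization.liftAlgHom
    (M := Submonoid.powers (MvPolynomial.X 0 : MvPolynomial (Fin 3) ℂ)) (f := g) (by
      rintro ⟨_, n, rfl⟩
      simp [hg0])
  have hk (p) : k (algebraMap _ L p) = g p := IsLocalization.lift_eq _ _
  let κ : ChartRing →ₐ[ℂ] MvPolynomial (Fin 2) ℂ := k.comp (IsScalarTower.toAlgHom ℂ ChartRing L)
  have hκ (i) : κ (chartCoordinate i) = g (MvPolynomial.X i) := by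
    have := congrArg k (X_mul_chartCoordinate i)
    rw [map_mul] at this
    rw [hk, hk, hg0, one_mul] at this
    exact this
  refine Function.LeftInverse.injective (g := κ) fun q => ?_
  have : κ.comp (MvPolynomial.aeval ![chartCoordinate 1, chartCoordinate 2]) = AlgHom.id ℂ _ := by
    ext i
    fin_cases i
    · simp [hκ, g]
    · simp [hκ, g]
  exact congrArg (fun φ => φ q) this

/-- The constants coming from the structure morphism of `Plane` agree with those of the chart ring,
which makes `chartRingHom` a map of `ℂ`-algebras. -/
theorem algebraMap_functionField_plane (c : ℂ) :
    algebraMap ℂ Plane.left.functionField c = Plane.left.germToFunctionField chart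
      (Proj.awayToSection planeGrading (MvPolynomial.X 0) (algebraMap ℂ ChartRing c)) := by
  let φ : CommRingCat.of ℂ ⟶ Γ(Plane.left, chart) :=
    CommRingCat.ofHom (algebraMap ℂ ChartRing) ≫
      Proj.awayToSection planeGrading (MvPolynomial.X 0)
  have h : chart.ι ≫ Plane.hom = chart.toSpecΓ ≫ Spec.map φ := by
    have e := Proj.awayι_toSpecZero planeGrading _ (X_mem 0) one_pos
    rw [Proj.awayι, Category.assoc, Iso.inv_comp_eq, Proj.basicOpenIsoSpec_hom,
      Proj.basicOpenToSpec, Category.assoc] at e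
    have e' := congrArg
      (· ≫ Spec.map (CommRingCat.ofHom (algebraMap ℂ (planeGrading 0)))) e
    simp only [Category.assoc, ← Spec.map_comp] at e'
    exact e'
  have hη : genericPoint Plane.left ∈ chart :=
    (genericPoint_specializes planePoint).mem_open chart.2
      (planePoint_mem_basicOpen (MvPolynomial.X_ne_zero 0))
  exact congrArg (fun ψ => ψ.hom c) (stalkStructure_eq_comp_germ Plane h hη)

/-- The coordinate ring of the chart `x₀ ≠ 0` inside the function field of the plane. -/
def chartRingHom : ChartRing →ₐ[ℂ] Plane.left.functionField where
  __ := (Proj.awayToSection planeGrading (MvPolynomial.X 0) ≫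
    Plane.left.germToFunctionField chart).hom
  commutes' c := (algebraMap_functionField_plane c).symm

theorem chartRingHom_chartCoordinate (i : Fin 3) :
    chartRingHom (chartCoordinate i) = coordinate i := rfl

theorem chartRingHom_injective : Function.Injective chartRingHom := by
  have h1 : Function.Injective (Proj.awayToSection planeGrading (MvPolynomial.X 0)) :=
    (Proj.basicOpenIsoAway planeGrading _ (X_mem 0) one_pos).commRingCatIsoToRingEquiv.injective
  exact (Plane.left.germToFunctionField_injective chart).comp h1

theorem exists_eq_div_chartRingHom (z : Plane.left.functionField) :
    ∃ a b, z = chartRingHom a / chartRingHom b := by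
  have hU : IsAffineOpen chart := Proj.isAffineOpen_basicOpen planeGrading _ (X_mem 0) one_pos
  have := functionField_isFractionRing_of_isAffineOpen Plane.left chart hU
  have h1 : Function.Surjective (Proj.awayToSection planeGrading (MvPolynomial.X 0)) :=
    (Proj.basicOpenIsoAway planeGrading _ (X_mem 0) one_pos).commRingCatIsoToRingEquiv.surjective
  obtain ⟨a, b, hb, rfl⟩ := IsFractionRing.div_surjective Γ(Plane.left, chart) z
  obtain ⟨a, rfl⟩ := h1 a
  obtain ⟨b, rfl⟩ := h1 b
  exact ⟨a, b, rfl⟩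

theorem comp_aeval_chartCoordinate :
    chartRingHom.comp (MvPolynomial.aeval ![chartCoordinate 1, chartCoordinate 2]) =
      MvPolynomial.aeval ![coordinate 1, coordinate 2] := by
  ext i
  fin_cases i
  · simp [chartRingHom_chartCoordinate]
  · simp [chartRingHom_chartCoordinate]

/-- The coordinates of the plane are algebraically independent. -/
theorem aeval_coordinate_injective :
    Function.Injective (MvPolynomial.aeval ![coordinate 1, coordinate 2] :
      MvPolynomial (Fin 2) ℂ →ₐ[ℂ] Plane.left.functionField) := by
  rw [← comp_aeval_chartCoordinate]
  exact chartRingHom_injective.comp aeval_chartCoordinate_injective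

/-- The rational functions on the plane are the quotients of polynomials in the coordinates. -/
theorem exists_eq_div_aeval_coordinate (z : Plane.left.functionField) :
    ∃ p q : MvPolynomial (Fin 2) ℂ, z = MvPolynomial.aeval ![coordinate 1, coordinate 2] p /
      MvPolynomial.aeval ![coordinate 1, coordinate 2] q := by
  obtain ⟨a, b, rfl⟩ := exists_eq_div_chartRingHom z
  obtain ⟨p, rfl⟩ := aeval_chartCoordinate_surjective a
  obtain ⟨q, rfl⟩ := aeval_chartCoordinate_surjective b
  exact ⟨p, q, by rw [← comp_aeval_chartCoordinate]; rfl⟩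

/-- A resolution of a pair that is crepant birational to the plane carries a monomial valuation of
rank two, with respect to which the volume form has order zero. -/
theorem IsCrepantBirationalToPlane.exists_algHom {X Y : CScheme} [IsIntegral X.left]
    [IsIntegral Y.left] {D : AlgebraicCycle X.left ℤ} (h : IsCrepantBirationalToPlane X D)
    (f : Y ⟶ X) [IsDominant f.left]
    (hf : ∃ U : X.left.Opens, Dense (U : Set X.left) ∧ IsIso (f.left ∣_ U)) :
    ∃ ω : RationalForm X, IsPoleDivisor X ω D ∧ ∃ (x₁ x₂ : Y.left.functionField) (c : ℂ),
      c ≠ 0 ∧ x₁ ≠ 0 ∧ x₂ ≠ 0 ∧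
      (x₁⁻¹ * x₂⁻¹) • dWedge x₁ x₂ =
        algebraMap ℂ Y.left.functionField c • pullbackForm f ω ∧
      ∃ ι : Y.left.functionField →ₐ[ℂ] BiSeries,
        ι x₁ = BiSeries.monomial 1 0 ∧ ι x₂ = BiSeries.monomial 0 1 := by
  obtain ⟨ω, hω, φ, hφ, hvol⟩ := h
  obtain ⟨U, hU, hUf⟩ := hf
  have := isIso_stalkMap_genericPoint f.left hU
  obtain ⟨ψ, c, hc, e⟩ := hvol.exists_algEquiv
  let θ := AlgEquiv.ofBijective _ (functionFieldMap_bijective f)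
  let χ := ψ.trans θ
  have hχ : (MvPolynomial.aeval ![χ (coordinate 1), χ (coordinate 2)] :
      MvPolynomial (Fin 2) ℂ →ₐ[ℂ] Y.left.functionField) =
      χ.toAlgHom.comp (MvPolynomial.aeval ![coordinate 1, coordinate 2]) := by
    ext i
    fin_cases i
    · simp
    · simp
  have hinj : Function.Injective (MvPolynomial.aeval ![χ (coordinate 1), χ (coordinate 2)] :
      MvPolynomial (Fin 2) ℂ →ₐ[ℂ] Y.left.functionField) := by
    rw [hχ]
    exact χ.injective.comp aeval_coordinate_injective
  refine ⟨ω, hω, χ (coordinate 1), χ (coordinate 2), c, hc, ?_, ?_, ?_,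
    BiSeries.exists_algHom _ _ hinj fun z => ?_⟩
  · intro h0
    exact MvPolynomial.X_ne_zero (0 : Fin 2) (hinj (by simpa using h0))
  · intro h0
    exact MvPolynomial.X_ne_zero (1 : Fin 2) (hinj (by simpa using h0))
  · have e1 := congrArg (mapForm θ.toAlgHom) e
    rw [mapForm_comp, mapForm_smul] at e1
    refine Eq.trans ?_ (e1.trans ?_)
    · rw [torusForm, mapForm_smul_dWedge, map_mul, map_inv₀, map_inv₀]
      rfl
    · congr 1
      exact θ.commutes c
  · obtain ⟨p, q, e⟩ := exists_eq_div_aeval_coordinate (χ.symm z)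
    refine ⟨p, q, ?_⟩
    rw [hχ, ← χ.apply_symm_apply z, e, map_div₀]
    rfl

instance isScalarTower_functionField (Y : CScheme) [IsIntegral Y.left] (y : Y.left) :
    IsScalarTower ℂ (Y.left.presheaf.stalk y) Y.left.functionField :=
  .of_algebraMap_eq fun c => (congrArg (fun φ => φ.hom c)
    (stalkStructure_stalkSpecializes Y (genericPoint_specializes y))).symm

/-! ### The centre of a valuation -/

/-- By the valuative criterion, the generic point of `Y` extends to a morphism from `Spec A`; the
centre is the image of the closed point. -/
theorem exists_center (Y : CScheme) [IsIntegral Y.left] [IsProper Y.hom]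
    (A : ValuationSubring Y.left.functionField)
    (hA : ∀ c : ℂ, algebraMap ℂ Y.left.functionField c ∈ A) :
    ∃ (y : Y.left) (ψ : Y.left.presheaf.stalk y →+* A), IsLocalHom ψ ∧
      ∀ a, (ψ a : Y.left.functionField) = algebraMap _ _ a := by
  let s : ℂ →+* A := (algebraMap ℂ Y.left.functionField).codRestrict A hA
  let i₁ : Spec (.of Y.left.functionField) ⟶ Y.left := Y.left.fromSpecStalk (genericPoint Y.left)
  let i₂ : Spec (.of A) ⟶ Spec (.of ℂ) := Spec.map (CommRingCat.ofHom s)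
  let incl : CommRingCat.of A ⟶ .of Y.left.functionField :=
    CommRingCat.ofHom (algebraMap A Y.left.functionField)
  have sq : CommSq i₁ (Spec.map incl) Y.hom i₂ := ⟨by
    simp only [i₁, i₂]
    refine (SpecMap_stalkStructure Y (genericPoint Y.left)).symm.trans ?_
    rw [← Spec.map_comp]
    rfl⟩
  have hval : ValuativeCriterion Y.hom := by
    have h : IsProper Y.hom := inferInstance
    rw [IsProper.eq_valuativeCriterion] at h
    exact h.1.1.1
  obtain ⟨⟨l, hl₁, -⟩⟩ := hval.existence
    { R := A, K := Y.left.functionField, i₁ := i₁, i₂ := i₂, commSq := sq }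
  let ψ := Scheme.stalkClosedPointTo l
  refine ⟨l (closedPoint A), ψ.hom, inferInstance, fun a => ?_⟩
  have e : ψ ≫ incl = Y.left.presheaf.stalkSpecializes
      (genericPoint_specializes (l (closedPoint A))) := by
    apply Spec.map_injective
    rw [← cancel_mono (Y.left.fromSpecStalk _), Spec.map_comp, Category.assoc,
      Scheme.Spec_stalkClosedPointTo_fromSpecStalk,
      Scheme.SpecMap_stalkSpecializes_fromSpecStalk]
    exact hl₁
  exact congrArg (fun φ => φ.hom a) e

/-- The local ring of the centre is dominated by the valuation ring. Its residue field is `ℂ`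
because subtracting the constant term of the series leaves an element of positive order, which
cannot be a unit. -/
theorem exists_center_of_algHom (Y : CScheme) [IsIntegral Y.left] [IsProper Y.hom]
    (ι : Y.left.functionField →ₐ[ℂ] BiSeries) :
    ∃ y : Y.left, HasComplexResidue (Y.left.presheaf.stalk y) ∧
      (∀ a : Y.left.presheaf.stalk y, 0 ≤ (ι (algebraMap _ _ a)).orderTop) ∧
      ∀ a ∈ maximalIdeal (Y.left.presheaf.stalk y), 0 < (ι (algebraMap _ _ a)).orderTop := by
  obtain ⟨y, ψ, hψ, h⟩ := exists_center Y (BiSeries.integers.comap ι.toRingHom) fun c => by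
    change 0 ≤ (ι (algebraMap ℂ _ c)).orderTop
    rw [AlgHom.commutes]
    exact BiSeries.zero_le_orderTop_algebraMap c
  have hnonneg (a : Y.left.presheaf.stalk y) : 0 ≤ (ι (algebraMap _ _ a)).orderTop := by
    rw [← h a]
    exact (ψ a).2
  refine ⟨y, fun a => ⟨(ι (algebraMap _ _ a)).coeff 0, ?_⟩, hnonneg, fun a ha => ?_⟩
  · intro hu
    obtain ⟨b, hb⟩ := hu.exists_right_inv
    have h1 := congrArg (fun z => (ι (algebraMap _ Y.left.functionField z)).orderTop) hb
    simp only [map_mul, map_one, HahnSeries.orderTop_mul, HahnSeries.orderTop_one] at h1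
    have h2 := BiSeries.orderTop_sub_coeff_zero_pos (hnonneg a)
    rw [map_sub, map_sub, ← IsScalarTower.algebraMap_apply ℂ, AlgHom.commutes] at h1
    exact (add_pos_of_pos_of_nonneg h2 (hnonneg b)).ne' h1
  · refine lt_of_le_of_ne (hnonneg a) fun h0 => ?_
    refine (mem_maximalIdeal a).mp ha (isUnit_of_map_unit ψ a ?_)
    have ha0 : ι (algebraMap _ _ a) ≠ 0 := by
      intro h1
      rw [h1] at h0
      simp at h0
    have hinv : (ι (algebraMap _ _ a)⁻¹).orderTop = 0 := by
      have := congrArg HahnSeries.orderTop (mul_inv_cancel₀ ha0)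
      rw [HahnSeries.orderTop_mul, ← h0, zero_add, HahnSeries.orderTop_one] at this
      rw [map_inv₀, this]
    refine IsUnit.of_mul_eq_one ⟨(algebraMap _ _ a)⁻¹, hinv.ge⟩ (Subtype.ext ?_)
    change (ψ a : Y.left.functionField) * _ = 1
    rw [h a]
    exact mul_inv_cancel₀ fun h1 => ha0 (by rw [h1, map_zero])

/-! ### Generizations of a point and primes of its local ring -/

section Generization

variable {Y : Scheme} {E y : Y}

instance isPrime_idealAt (h : E ⤳ y) : (idealAt h).IsPrime := by
  unfold idealAt
  infer_instance

theorem fromSpecStalk_idealAt (h : E ⤳ y) :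
    Y.fromSpecStalk y ⟨idealAt h, isPrime_idealAt h⟩ = E := by
  have h1 := congrArg (fun φ => φ (closedPoint (Y.presheaf.stalk E)))
    (Y.SpecMap_stalkSpecializes_fromSpecStalk h)
  simp only [Scheme.fromSpecStalk_closedPoint] at h1
  exact h1

theorem eq_of_idealAt_eq {E' : Y} {h : E ⤳ y} {h' : E' ⤳ y} (e : idealAt h = idealAt h') :
    E = E' := by
  rw [← fromSpecStalk_idealAt h, ← fromSpecStalk_idealAt h']
  exact congrArg _ (PrimeSpectrum.ext e)

theorem exists_idealAt_eq (P : Ideal (Y.presheaf.stalk y)) (hP : P.IsPrime) :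
    ∃ (E : Y) (h : E ⤳ y), idealAt h = P := by
  have h : Y.fromSpecStalk y ⟨P, hP⟩ ⤳ y := by
    have := Set.mem_range_self (f := Y.fromSpecStalk y) ⟨P, hP⟩
    rwa [Scheme.range_fromSpecStalk] at this
  refine ⟨_, h, ?_⟩
  have := (Y.fromSpecStalk y).isEmbedding.injective (fromSpecStalk_idealAt h)
  exact congrArg PrimeSpectrum.asIdeal this

theorem mem_idealAt_iff (h : E ⤳ y) {a : Y.presheaf.stalk y} :
    a ∈ idealAt h ↔ Y.presheaf.stalkSpecializes h a ∈ maximalIdeal (Y.presheaf.stalk E) := .rfl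

theorem isUnit_stalkSpecializes (h : E ⤳ y) {a : Y.presheaf.stalk y} (ha : a ∉ idealAt h) :
    IsUnit (Y.presheaf.stalkSpecializes h a) := by
  by_contra h'
  exact ha h'

/-- An affine neighbourhood of `y` contains `E`, and the stalk at `E` is a localization of its
coordinate ring; fractions of sections become fractions of germs at `y`. -/
theorem exists_stalkSpecializes_mul_eq (h : E ⤳ y) (a : Y.presheaf.stalk E) :
    ∃ p q : Y.presheaf.stalk y, q ∉ idealAt h ∧
      a * Y.presheaf.stalkSpecializes h q = Y.presheaf.stalkSpecializes h p := by
  obtain ⟨_, ⟨V, hV, rfl⟩, hyV, -⟩ :=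
    Y.isBasis_affineOpens.exists_subset_of_mem_open (Set.mem_univ y) isOpen_univ
  have hEV : E ∈ V := h.mem_open V.2 hyV
  let : Algebra Γ(Y, V) (Y.presheaf.stalk E) :=
    TopCat.Presheaf.algebra_section_stalk Y.presheaf ⟨E, hEV⟩
  have hloc : IsLocalization.AtPrime (Y.presheaf.stalk E) (hV.primeIdealOf ⟨E, hEV⟩).asIdeal :=
    hV.isLocalization_stalk ⟨E, hEV⟩
  obtain ⟨⟨g, s⟩, e⟩ := IsLocalization.surj (hV.primeIdealOf ⟨E, hEV⟩).asIdeal.primeCompl a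
  have hg (z : Γ(Y, V)) : Y.presheaf.stalkSpecializes h (Y.presheaf.germ V y hyV z) =
      algebraMap Γ(Y, V) (Y.presheaf.stalk E) z :=
    congrArg (fun φ => φ.hom z) (Y.presheaf.germ_stalkSpecializes hyV h)
  refine ⟨Y.presheaf.germ V y hyV g, Y.presheaf.germ V y hyV s, fun hs => ?_, ?_⟩
  · rw [mem_idealAt_iff, hg] at hs
    exact hs (IsLocalization.map_units _ s)
  · rw [hg, hg]
    exact e

variable [IsIntegral Y]

theorem algebraMap_stalkSpecializes (h : E ⤳ y) (a : Y.presheaf.stalk y) :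
    algebraMap _ Y.functionField (Y.presheaf.stalkSpecializes h a) = algebraMap _ _ a := by
  have := Y.presheaf.stalkSpecializes_comp ((genericPoint_spec Y).specializes trivial) h
  exact congrArg (fun φ => φ.hom a) this

theorem algebraMap_stalk_injective (y : Y) :
    Function.Injective (algebraMap (Y.presheaf.stalk y) Y.functionField) :=
  IsFractionRing.injective _ _

theorem stalkSpecializes_injective (h : E ⤳ y) :
    Function.Injective (Y.presheaf.stalkSpecializes h) := fun a b hab =>
  algebraMap_stalk_injective y (by
    rw [← algebraMap_stalkSpecializes h, hab, algebraMap_stalkSpecializes])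

theorem isLocalization_stalkSpecializes (h : E ⤳ y) :
    letI := (Y.presheaf.stalkSpecializes h).hom.toAlgebra
    IsLocalization.AtPrime (Y.presheaf.stalk E) (idealAt h) := by
  let := (Y.presheaf.stalkSpecializes h).hom.toAlgebra
  refine ⟨?_, ?_, ?_⟩
  · rintro ⟨s, hs⟩
    exact isUnit_stalkSpecializes h hs
  · intro a
    obtain ⟨p, q, hq, e⟩ := exists_stalkSpecializes_mul_eq h a
    exact ⟨⟨p, q, hq⟩, e⟩
  · intro a b hab
    exact ⟨1, by rw [stalkSpecializes_injective h hab]⟩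

theorem height_idealAt (h : E ⤳ y) : (idealAt h).height = coheight E := by
  let := (Y.presheaf.stalkSpecializes h).hom.toAlgebra
  have := isLocalization_stalkSpecializes h
  have h1 := IsLocalization.AtPrime.ringKrullDim_eq_height (idealAt h) (Y.presheaf.stalk E)
  rw [ringKrullDim_stalk_eq_coheight] at h1
  exact_mod_cast h1.symm

theorem maximalIdeal_eq_span_of_idealAt_eq (h : E ⤳ y) {s : Y.presheaf.stalk y}
    (hs : idealAt h = Ideal.span {s}) :
    maximalIdeal (Y.presheaf.stalk E) = Ideal.span {Y.presheaf.stalkSpecializes h s} := by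
  let := (Y.presheaf.stalkSpecializes h).hom.toAlgebra
  have := isLocalization_stalkSpecializes h
  have h1 := IsLocalization.AtPrime.map_eq_maximalIdeal (idealAt h) (Y.presheaf.stalk E)
  rw [← h1, hs, Ideal.map_span, Set.image_singleton]
  rfl

end Generization

/-- The field of fractions of a Noetherian local domain with principal maximal ideal. -/
theorem exists_eq_mul_zpow {O K : Type*} [CommRing O] [IsDomain O] [IsLocalRing O]
    [IsNoetherianRing O] [Field K] [Algebra O K] [IsFractionRing O K] {t : O}
    (ht : maximalIdeal O = Ideal.span {t}) (ht0 : t ≠ 0) (x : K) (hx : x ≠ 0) :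
    ∃ u ∈ (algebraMap O K).range, u⁻¹ ∈ (algebraMap O K).range ∧ u ≠ 0 ∧
      ∃ n : ℤ, x = u * algebraMap O K t ^ n := by
  have hinj : Function.Injective (algebraMap O K) := IsFractionRing.injective O K
  have hprime : Prime t := by
    rw [← Ideal.span_singleton_prime ht0, ← ht]
    infer_instance
  have key (a : O) (ha : a ≠ 0) : ∃ (u : Oˣ) (n : ℕ), a = u * t ^ n := by
    have hf : FiniteMultiplicity t a := FiniteMultiplicity.of_not_isUnit hprime.not_isUnit ha
    obtain ⟨b, hb, hb'⟩ := hf.exists_eq_pow_mul_and_not_dvd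
    have hu : IsUnit b := by
      by_contra h
      have : b ∈ maximalIdeal O := h
      rw [ht, Ideal.mem_span_singleton] at this
      exact hb' this
    exact ⟨hu.unit, _, by rw [hb, mul_comm]; rfl⟩
  obtain ⟨a, b, hb, rfl⟩ := IsFractionRing.div_surjective O x
  have hb0 : b ≠ 0 := nonZeroDivisors.ne_zero hb
  have ha0 : a ≠ 0 := by
    rintro rfl
    simp at hx
  obtain ⟨u, n, rfl⟩ := key a ha0
  obtain ⟨v, m, rfl⟩ := key b hb0
  have hunit (w : Oˣ) : algebraMap O K w ≠ 0 := (w.isUnit.map (algebraMap O K)).ne_zero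
  have hinv (w : Oˣ) : algebraMap O K (↑w⁻¹ : O) = (algebraMap O K w)⁻¹ := by
    refine eq_inv_of_mul_eq_one_left ?_
    rw [← map_mul, Units.inv_mul, map_one]
  have ht' : algebraMap O K t ≠ 0 := fun h => ht0 (hinj (by rw [h, map_zero]))
  refine ⟨algebraMap O K (u * v⁻¹ : Oˣ), ⟨_, rfl⟩, ⟨_, hinv _⟩, hunit _, n - m, ?_⟩
  rw [Units.val_mul, map_mul (algebraMap O K) (u : O) (↑v⁻¹ : O), hinv, map_mul, map_mul, map_pow, map_pow, zpow_sub₀ ht',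
    zpow_natCast, zpow_natCast]
  field_simp

/-! ### Regular forms on smooth surfaces -/

theorem functionFieldMap_algebraMap {X Y : CScheme} [IsIntegral X.left] [IsIntegral Y.left]
    (f : Y ⟶ X) [IsDominant f.left] (y : Y.left) (a : X.left.presheaf.stalk (f.left y)) :
    functionFieldMap f (algebraMap _ _ a) = algebraMap _ _ (f.left.stalkMap y a) := by
  have h1 := f.left.stalkSpecializes_stalkMap _ _ (genericPoint_specializes y)
  have h2 := X.left.presheaf.stalkSpecializes_comp
    (specializes_genericPoint f.left) (genericPoint_specializes (f.left y))
  have h3 : (X.left.presheaf.stalkSpecializes (genericPoint_specializes (f.left y)) ≫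
      X.left.presheaf.stalkSpecializes (specializes_genericPoint f.left) ≫
        f.left.stalkMap (genericPoint Y.left)) =
      f.left.stalkMap y ≫ Y.left.presheaf.stalkSpecializes (genericPoint_specializes y) := by
    rw [← h1, ← Category.assoc, h2]
  exact congrArg (fun φ => φ.hom a) h3

theorem pullbackForm_mem_regularForms {X Y : CScheme} [IsIntegral X.left] [IsIntegral Y.left]
    (f : Y ⟶ X) [IsDominant f.left] {y : Y.left} {ω : RationalForm X}
    (h : ω ∈ regularForms X (f.left y)) : pullbackForm f ω ∈ regularForms Y y := by
  refine mapForm_mem_regularSpan (functionFieldMap f) (R := localRing X (f.left y)) ?_ h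
  rintro _ ⟨a, rfl⟩
  exact ⟨_, (functionFieldMap_algebraMap f y a).symm⟩

theorem IsPoleDivisor.mem_regularForms {X : CScheme} [IsIntegral X.left] {x : X.left}
    [IsNoetherianRing (X.left.presheaf.stalk x)]
    {ω : RationalForm X} {D : AlgebraicCycle X.left ℤ} (h : IsPoleDivisor X ω D)
    (hx : coheight x = 1) (hD : D x = 0) : ω ∈ regularForms X x := by
  -- The pole condition at `x` is quantified over uniformizers, so one has to exist before the
  -- condition gives anything.
  obtain ⟨t, ht⟩ : ∃ t : X.left.presheaf.stalk x, Irreducible t := by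
    have h1 : ¬ IsField (X.left.presheaf.stalk x) := fun hf => by
      have h2 := ringKrullDim_stalk_eq_coheight x
      rw [ringKrullDim_eq_zero_of_isField hf, hx] at h2
      exact absurd h2 (by norm_num)
    obtain ⟨a, ha0, ha⟩ := Ring.exists_not_isUnit_of_not_isField h1
    obtain ⟨t, ht, -⟩ := WfDvdMonoid.exists_irreducible_factor ha ha0
    exact ⟨t, ht⟩
  have h1 := h.2 x hx t ht
  rw [hD, zpow_zero, one_smul] at h1
  rw [← h1]
  exact Submodule.mem_span_singleton_self ω

theorem localRing_le {Y : CScheme} [IsIntegral Y.left] {E y : Y.left} (h : E ⤳ y) :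
    localRing Y y ≤ localRing Y E := by
  rintro _ ⟨a, rfl⟩
  exact ⟨_, algebraMap_stalkSpecializes h a⟩

theorem inv_mem_localRing {Y : CScheme} [IsIntegral Y.left] {E y : Y.left} (h : E ⤳ y)
    {q : Y.left.presheaf.stalk y} (hq : q ∉ idealAt h) :
    (algebraMap _ Y.left.functionField q)⁻¹ ∈ localRing Y E := by
  obtain ⟨b, hb⟩ := (isUnit_stalkSpecializes h hq).exists_right_inv
  refine ⟨b, eq_inv_of_mul_eq_one_right ?_⟩
  rw [← algebraMap_stalkSpecializes h, ← map_mul, hb, map_one]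

theorem exists_fraction {Y : CScheme} [IsIntegral Y.left] {E y : Y.left} (h : E ⤳ y)
    {a : Y.left.functionField} (ha : a ∈ localRing Y E) :
    ∃ p q : Y.left.presheaf.stalk y, q ∉ idealAt h ∧
      a * algebraMap _ _ q = algebraMap _ _ p := by
  obtain ⟨a, rfl⟩ := ha
  obtain ⟨p, q, hq, e⟩ := exists_stalkSpecializes_mul_eq h a
  refine ⟨p, q, hq, ?_⟩
  rw [← algebraMap_stalkSpecializes h, ← map_mul, e, algebraMap_stalkSpecializes]

theorem not_mem_idealAt_ne_zero {Y : CScheme} [IsIntegral Y.left] {E y : Y.left} {h : E ⤳ y}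
    {q : Y.left.presheaf.stalk y} (hq : q ∉ idealAt h) :
    algebraMap _ Y.left.functionField q ≠ 0 := by
  intro h0
  rw [(algebraMap_stalk_injective y).eq_iff' (map_zero _)] at h0
  exact hq (h0 ▸ zero_mem _)

section Parameters

variable {Y : CScheme} [IsIntegral Y.left] [SmoothOfRelativeDimension 2 Y.hom] {y : Y.left}

/-- The differentials of parameters at `y` span at `y` by Nakayama, hence at every generization of
`y` by the quotient rule. -/
theorem D_mem_span_of_parameters (hres : HasComplexResidue (Y.left.presheaf.stalk y)) {n : ℕ}
    {t : Fin n → Y.left.presheaf.stalk y}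
    (ht : Ideal.span (Set.range t) = maximalIdeal (Y.left.presheaf.stalk y))
    {E : Y.left} (h : E ⤳ y) {a : Y.left.functionField} (ha : a ∈ localRing Y E) :
    KaehlerDifferential.D ℂ Y.left.functionField a ∈ Submodule.span (localRing Y E)
      (Set.range fun i => KaehlerDifferential.D ℂ Y.left.functionField (algebraMap _ _ (t i))) := by
  refine D_mem_span_of_fractions (localRing_le h) (fun b hb => ?_) (fun b hb => ?_) ha
  · exact D_mem_span_range (hres.span_D_eq_top ht) hb
  · obtain ⟨p, q, hq, e⟩ := exists_fraction h hb
    exact ⟨_, ⟨p, rfl⟩, _, ⟨q, rfl⟩, inv_mem_localRing h hq,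
      (eq_mul_inv_iff_mul_eq₀ (not_mem_idealAt_ne_zero hq)).mpr e⟩

theorem exists_eq_smul_of_mem_regularForms (hres : HasComplexResidue (Y.left.presheaf.stalk y))
    {t : Fin 2 → Y.left.presheaf.stalk y}
    (ht : Ideal.span (Set.range t) = maximalIdeal (Y.left.presheaf.stalk y))
    {E : Y.left} (h : E ⤳ y) {η : RationalForm Y} (hη : η ∈ regularForms Y E) :
    ∃ c ∈ localRing Y E, η = c • dWedge (algebraMap _ _ (t 0)) (algebraMap _ _ (t 1)) := by
  refine exists_smul_of_mem_regularSpan (fun a ha => ?_) hη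
  convert D_mem_span_of_parameters hres ht h ha using 2
  ext z
  simp [Fin.exists_fin_two, eq_comm]

/-- With at most one parameter, the differentials of `K(Y)` are spanned by a single element, and `ds
∧ ds = 0`. As the volume form is nonzero, its centre must therefore have two parameters. -/
theorem eq_zero_of_parameters_of_le_one (hres : HasComplexResidue (Y.left.presheaf.stalk y))
    {n : ℕ} (hn : n ≤ 1) {t : Fin n → Y.left.presheaf.stalk y}
    (ht : Ideal.span (Set.range t) = maximalIdeal (Y.left.presheaf.stalk y))
    (η : RationalForm Y) : η = 0 := by
  obtain ⟨s, hs⟩ : ∃ s, Set.range (fun i => KaehlerDifferential.D ℂ Y.left.functionField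
      (algebraMap _ _ (t i))) ⊆ {KaehlerDifferential.D ℂ Y.left.functionField s,
        KaehlerDifferential.D ℂ Y.left.functionField s} := by
    interval_cases n
    · exact ⟨0, by simp⟩
    · refine ⟨algebraMap _ _ (t 0), ?_⟩
      rintro _ ⟨i, rfl⟩
      simp [Subsingleton.elim i 0]
  have htop (a : Y.left.functionField) : a ∈ localRing Y (genericPoint Y.left) := by
    refine ⟨a, ?_⟩
    have := Y.left.presheaf.stalkSpecializes_refl (genericPoint Y.left)
    exact congrArg (fun φ => φ.hom a) this
  induction η using form_induction with
  | zero => rfl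
  | add η θ h h' => rw [h, h', add_zero]
  | smul c a b =>
    obtain ⟨d, -, hd⟩ := exists_smul_of_mem_regularSpan (s := s) (t := s)
      (fun a ha => Submodule.span_mono hs
        (D_mem_span_of_parameters hres ht (genericPoint_specializes y) ha))
      (dWedge_mem_regularSpan (htop a) (htop b))
    rw [hd, dWedge_self, smul_zero, smul_zero]

end Parameters

/-! ### The node -/

section RegularSystem

theorem prod_fin_two_eq_mul {M : Type*} [CommMonoid M] {i j : Fin 2} (hij : i ≠ j) (f : Fin 2 → M) :
    ∏ k, f k = f i * f j := by
  fin_cases i <;> fin_cases j <;> simp_all [mul_comm]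

variable {O : Type} [CommRing O] [IsLocalRing O] {t : Fin 2 → O}

theorem span_pair_of_span_range (ht : Ideal.span (Set.range t) = maximalIdeal O) {i j : Fin 2}
    (hij : i ≠ j) : Ideal.span {t i, t j} = maximalIdeal O := by
  rw [← ht]
  congr 1
  ext z
  fin_cases i <;> fin_cases j <;> simp_all [Fin.exists_fin_two, eq_comm, or_comm]

variable [IsNoetherianRing O]

theorem not_dvd_of_regularSystem (ht : Ideal.span (Set.range t) = maximalIdeal O)
    (hdim : ringKrullDim O = 2) {i j : Fin 2} (hij : i ≠ j) : ¬ t i ∣ t j :=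
  not_dvd_of_span_pair (span_pair_of_span_range ht hij)
    (by rw [hdim]; exact_mod_cast one_lt_two)

theorem ne_zero_of_regularSystem (ht : Ideal.span (Set.range t) = maximalIdeal O)
    (hdim : ringKrullDim O = 2) (i : Fin 2) : t i ≠ 0 := by
  obtain ⟨j, hj⟩ : ∃ j, j ≠ i := exists_ne i
  intro h0
  exact not_dvd_of_regularSystem ht hdim hj (h0 ▸ dvd_zero _)

theorem isPrime_span_of_regularSystem (ht : Ideal.span (Set.range t) = maximalIdeal O)
    (hdim : ringKrullDim O = 2) (i : Fin 2) : (Ideal.span {t i}).IsPrime := by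
  obtain ⟨j, hj⟩ : ∃ j, j ≠ i := exists_ne i
  exact isPrime_span_singleton (span_pair_of_span_range ht hj.symm)
    (by rw [hdim]; exact_mod_cast one_lt_two)

variable [IsDomain O]

theorem height_span_of_regularSystem (ht : Ideal.span (Set.range t) = maximalIdeal O)
    (hdim : ringKrullDim O = 2) (i : Fin 2) : (Ideal.span {t i}).height = 1 := by
  have := isPrime_span_of_regularSystem ht hdim i
  refine le_antisymm (Ideal.height_le_one_of_isPrincipal_of_mem_minimalPrimes (Ideal.span {t i})
    _ (by rw [Ideal.minimalPrimes_eq_subsingleton_self]; rfl)) (Order.one_le_iff_ne_zero.mpr ?_)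
  rw [Ne, Ideal.height_eq_zero_iff_eq_bot, Ideal.span_singleton_eq_bot]
  exact ne_zero_of_regularSystem ht hdim i

theorem eq_span_of_mem_of_height_eq_one (ht : Ideal.span (Set.range t) = maximalIdeal O)
    (hdim : ringKrullDim O = 2) {i : Fin 2} {P : Ideal O} (hP : P.height = 1)
    (h : t i ∈ P) : P = Ideal.span {t i} := by
  have := isPrime_span_of_regularSystem ht hdim i
  refine (Ideal.eq_of_le_of_height_le _ ((Ideal.span_singleton_le_iff_mem P).mpr h) ?_).symm
  rw [hP, height_span_of_regularSystem ht hdim i]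

end RegularSystem

/-! ### Poles of the volume form along curves through the centre -/

variable {Y : CScheme} [IsIntegral Y.left] [SmoothOfRelativeDimension 2 Y.hom] {y : Y.left}

/-- The volume form has at most simple poles if it is logarithmic at the generic point. -/
theorem poleOrder_le_one {E : Y.left} (h : E ⤳ y) {s : Y.left.presheaf.stalk y}
    (hs : idealAt h = Ideal.span {s}) (hs0 : s ≠ 0) (hE : coheight E = 1) {ω : RationalForm Y}
    {N : AlgebraicCycle Y.left ℤ} (hN : IsPoleDivisor Y ω N) (hω : ω ≠ 0)
    {x₁ x₂ : Y.left.functionField} (hx₁ : x₁ ≠ 0) (hx₂ : x₂ ≠ 0) {c : ℂ} (hc : c ≠ 0)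
    (e : (x₁⁻¹ * x₂⁻¹) • dWedge x₁ x₂ = algebraMap ℂ Y.left.functionField c • ω) : N E ≤ 1 := by
  have := isNoetherianRing_stalk Y E
  set σ := Y.left.presheaf.stalkSpecializes h s with hσ
  have hmax : maximalIdeal (Y.left.presheaf.stalk E) = Ideal.span {σ} :=
    maximalIdeal_eq_span_of_idealAt_eq h hs
  have hσ0 : σ ≠ 0 := fun h0 => hs0 (stalkSpecializes_injective h (h0.trans (map_zero _).symm))
  have hprime : Prime σ := by
    rw [← Ideal.span_singleton_prime hσ0, ← hmax]
    infer_instance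
  have hinj := algebraMap_stalk_injective E
  have hσ0' : algebraMap _ Y.left.functionField σ ≠ 0 := fun h0 =>
    hσ0 (hinj (h0.trans (map_zero _).symm))
  have hlog : algebraMap _ Y.left.functionField σ • algebraMap ℂ Y.left.functionField c • ω ∈
      regularForms Y E := by
    rw [← e]
    exact smul_logForm_mem_regularSpan (R := localRing Y E) ⟨σ, rfl⟩
      (exists_eq_mul_zpow hmax hσ0) hx₁ hx₂ hσ0'
  rw [← hN.2 E hE σ hprime.irreducible, Submodule.mem_span_singleton] at hlog
  obtain ⟨⟨_, r, rfl⟩, hr⟩ := hlog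
  by_contra! hlt
  -- With pole order `k + 2`, regularity of `σ c ω` reads `σ c = r σ^(k+2)`, so `σ` would divide the
  -- nonzero constant `c`.
  obtain ⟨k, hk⟩ : ∃ k : ℕ, N E = k + 2 := ⟨(N E - 2).toNat, by omega⟩
  have h1 : algebraMap (Y.left.presheaf.stalk E) Y.left.functionField (r * σ ^ (k + 2)) =
      algebraMap _ _ (σ * algebraMap ℂ (Y.left.presheaf.stalk E) c) := by
    apply smul_left_injective _ hω
    change _ • ω = _ • ω
    rw [map_mul, map_mul, mul_smul, mul_smul, map_pow, ← IsScalarTower.algebraMap_apply ℂ]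
    rw [hk, show ((k : ℤ) + 2) = ((k + 2 : ℕ) : ℤ) by push_cast; rfl, zpow_natCast] at hr
    exact hr
  have h2 : r * σ ^ k * σ = algebraMap ℂ (Y.left.presheaf.stalk E) c :=
    mul_left_cancel₀ hσ0 (by rw [← hinj h1]; ring)
  exact hprime.not_isUnit (isUnit_of_dvd_unit (Dvd.intro_left _ h2) ((IsUnit.mk0 c hc).map _))

/-- Rational functions without poles along curves through a regular point are regular there. -/
theorem mem_localRing_of_forall {t : Fin 2 → Y.left.presheaf.stalk y}
    (ht : Ideal.span (Set.range t) = maximalIdeal (Y.left.presheaf.stalk y))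
    (hdim : ringKrullDim (Y.left.presheaf.stalk y) = 2) {g : Y.left.functionField}
    (hg : ∀ E : Y.left, E ⤳ y → coheight E = 1 → g ∈ localRing Y E) : g ∈ localRing Y y := by
  have := isNoetherianRing_stalk Y y
  obtain ⟨p, q, hq, rfl⟩ := IsFractionRing.div_surjective (Y.left.presheaf.stalk y) g
  have hq0 : q ≠ 0 := nonZeroDivisors.ne_zero hq
  have hinj := algebraMap_stalk_injective y
  have hq0' : algebraMap _ Y.left.functionField q ≠ 0 := fun h0 =>
    hq0 (hinj (h0.trans (map_zero _).symm))
  obtain ⟨b, rfl⟩ : q ∣ p := by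
    refine dvd_of_forall_height_one (span_pair_of_span_range ht zero_ne_one) hdim hq0
      fun P hP hP1 => ?_
    obtain ⟨E, h, rfl⟩ := exists_idealAt_eq P hP
    rw [height_idealAt] at hP1
    obtain ⟨a, r, hr, e⟩ := exists_fraction h (hg E h hP1)
    refine ⟨r, hr, a, hinj ?_⟩
    rw [map_mul, map_mul, ← e]
    field_simp
  refine ⟨b, ?_⟩
  rw [map_mul]
  field_simp

/-- Along `F i` the power of `t i` cancels the pole and the other parameter is a unit. Along any
other curve through `y` both parameters are units and `ω` is regular. -/
theorem zpow_mul_zpow_smul_mem_regularForms {t : Fin 2 → Y.left.presheaf.stalk y}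
    (ht : Ideal.span (Set.range t) = maximalIdeal (Y.left.presheaf.stalk y))
    (hdim : ringKrullDim (Y.left.presheaf.stalk y) = 2) {ω : RationalForm Y}
    {N : AlgebraicCycle Y.left ℤ} (hN : IsPoleDivisor Y ω N) {F : Fin 2 → Y.left}
    {hF : ∀ i, F i ⤳ y} (hFt : ∀ i, idealAt (hF i) = Ideal.span {t i})
    (hreg : ∀ (E : Y.left) (h : E ⤳ y), coheight E = 1 →
      (∀ i, idealAt h ≠ Ideal.span {t i}) → ω ∈ regularForms Y E)
    {E : Y.left} (h : E ⤳ y) (hE : coheight E = 1) :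
    (∏ i, algebraMap _ Y.left.functionField (t i) ^ N (F i)) • ω ∈ regularForms Y E := by
  have := isNoetherianRing_stalk Y y
  have hunit (i : Fin 2) (hi : idealAt h ≠ Ideal.span {t i}) (n : ℤ) :
      algebraMap _ Y.left.functionField (t i) ^ n ∈ localRing Y E := by
    have hti : t i ∉ idealAt h := fun hmem => hi
      (eq_span_of_mem_of_height_eq_one ht hdim (by rw [height_idealAt, hE]) hmem)
    obtain ⟨n, rfl | rfl⟩ := n.eq_nat_or_neg
    · rw [zpow_natCast]
      exact pow_mem (localRing_le h ⟨_, rfl⟩) n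
    · rw [zpow_neg, zpow_natCast, ← inv_pow]
      exact pow_mem (inv_mem_localRing h hti) n
  by_cases hex : ∃ i, idealAt h = Ideal.span {t i}
  · obtain ⟨i, hi⟩ := hex
    obtain ⟨j, hj⟩ : ∃ j, j ≠ i := exists_ne i
    obtain rfl : E = F i := eq_of_idealAt_eq (hi.trans (hFt i).symm)
    have hprod : ∏ i, algebraMap _ Y.left.functionField (t i) ^ N (F i) =
        algebraMap _ Y.left.functionField (t j) ^ N (F j) *
          algebraMap _ Y.left.functionField (t i) ^ N (F i) := 
      prod_fin_two_eq_mul hj _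
    rw [hprod, mul_smul]
    refine smul_mem_of_mem (hunit j (fun hij => ?_) _) ?_
    · have := hi.symm.trans hij
      rw [Ideal.span_singleton_eq_span_singleton] at this
      exact not_dvd_of_regularSystem ht hdim hj this.dvd'
    · have hmax := maximalIdeal_eq_span_of_idealAt_eq h hi
      have hσ0 : Y.left.presheaf.stalkSpecializes h (t i) ≠ 0 := fun h0 =>
        ne_zero_of_regularSystem ht hdim i
          (stalkSpecializes_injective h (h0.trans (map_zero _).symm))
      have hprime : Prime (Y.left.presheaf.stalkSpecializes h (t i)) := by
        rw [← Ideal.span_singleton_prime hσ0, ← hmax]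
        infer_instance
      have h1 := hN.2 (F i) hE _ hprime.irreducible
      rw [algebraMap_stalkSpecializes] at h1
      rw [← h1]
      exact Submodule.mem_span_singleton_self _
  · push Not at hex
    rw [Fin.prod_univ_two]
    exact smul_mem_of_mem (mul_mem (hunit 0 (hex 0) _) (hunit 1 (hex 1) _)) (hreg E h hE hex)

/-- The logarithmic form has coefficient `1`, and nonzero constants have order zero. -/
theorem orderTop_logCoefficient_eq_zero {K : Type} [Field K] [Algebra ℂ K] {ι : K →ₐ[ℂ] BiSeries}
    {x₁ x₂ : K} (h₁ : ι x₁ = BiSeries.monomial 1 0) (h₂ : ι x₂ = BiSeries.monomial 0 1)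
    {c : ℂ} (hc : c ≠ 0) {ω : ⋀[K]^2 Ω[K⁄ℂ]}
    (e : (x₁⁻¹ * x₂⁻¹) • dWedge x₁ x₂ = algebraMap ℂ K c • ω) :
    (logCoefficient ι ω).orderTop = 0 := by
  have h := congrArg (fun η => (logCoefficient ι η).orderTop) e
  simp only [logCoefficient_logForm ι h₁ h₂, logCoefficient_smul, AlgHom.commutes,
    HahnSeries.orderTop_mul, BiSeries.orderTop_algebraMap hc, zero_add,
    HahnSeries.orderTop_one] at h
  exact h.symm

section Coefficients

variable {Y : CScheme} [IsIntegral Y.left] [SmoothOfRelativeDimension 2 Y.hom] {y : Y.left}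

/-- At the centre of a valuation at which the volume form has log discrepancy zero, both
coordinate curves have coefficient one. -/
theorem eq_one_of_orderTop_eq_zero (hres : HasComplexResidue (Y.left.presheaf.stalk y))
    {t : Fin 2 → Y.left.presheaf.stalk y}
    (ht : Ideal.span (Set.range t) = maximalIdeal (Y.left.presheaf.stalk y))
    (hdim : ringKrullDim (Y.left.presheaf.stalk y) = 2) {ω : RationalForm Y}
    {a : Fin 2 → ℤ} (ha : ∀ i, a i ≤ 1)
    (hreg : ∀ E : Y.left, E ⤳ y → coheight E = 1 →
      (∏ i, algebraMap _ Y.left.functionField (t i) ^ a i) • ω ∈ regularForms Y E)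
    {F : Y.left} (hF : F ⤳ y) (hF1 : coheight F = 1)
    {ι : Y.left.functionField →ₐ[ℂ] BiSeries} (hω : (logCoefficient ι ω).orderTop = 0)
    (hpos : ∀ a ∈ maximalIdeal (Y.left.presheaf.stalk y), 0 < (ι (algebraMap _ _ a)).orderTop)
    (i : Fin 2) : a i = 1 := by
  have := isNoetherianRing_stalk Y y
  set τ : Fin 2 → Y.left.functionField := fun i => algebraMap _ _ (t i) with hτ
  have hτ0 (i) : τ i ≠ 0 := fun h0 => ne_zero_of_regularSystem ht hdim i
    (algebraMap_stalk_injective y (h0.trans (map_zero _).symm))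
  have hω0 : ω ≠ 0 := by
    rintro rfl
    simp at hω
  set η : RationalForm Y := (∏ i, τ i ^ a i) • ω with hη
  have hη0 : η ≠ 0 :=
    smul_ne_zero (Finset.prod_ne_zero_iff.mpr fun i _ => zpow_ne_zero _ (hτ0 i)) hω0
  obtain ⟨g, hg⟩ : ∃ g, η = g • dWedge (τ 0) (τ 1) := by
    obtain ⟨g, -, hg⟩ := exists_eq_smul_of_mem_regularForms hres ht hF (hreg F hF hF1)
    exact ⟨g, hg⟩
  have hW : (dWedge (τ 0) (τ 1) : RationalForm Y) ≠ 0 := by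
    intro h0
    apply hη0
    rw [hg, h0, smul_zero]
  -- The coefficient of `η` is unique because `dt₀ ∧ dt₁ ≠ 0`. It is regular along every curve
  -- through `y`, hence at `y`.
  obtain ⟨g', rfl⟩ : g ∈ localRing Y y := by
    refine mem_localRing_of_forall ht hdim fun E hE hE1 => ?_
    obtain ⟨c, hc, hc'⟩ := exists_eq_smul_of_mem_regularForms hres ht hE (hreg E hE hE1)
    rwa [smul_left_injective _ hW (hg.symm.trans hc')]
  -- The bound `a i ≤ 1` makes this truncation exact. Multiplying `η` by the powers `t i ^ b i`
  -- gives `t₀ t₁ ω`, whose order is exactly `ord t₀ + ord t₁`.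
  set b : Fin 2 → ℕ := fun i => (1 - a i).toNat with hb
  have hbτ (i) : τ i ^ b i * τ i ^ a i = τ i := by
    rw [← zpow_natCast, ← zpow_add₀ (hτ0 i)]
    have : (b i : ℤ) + a i = 1 := by
      simp only [hb]
      have := ha i
      omega
    rw [this, zpow_one]
  set z := (∏ i, t i ^ b i) * g' with hz
  have key : (∏ i, τ i) • ω = algebraMap _ Y.left.functionField z • dWedge (τ 0) (τ 1) := by
    have h1 : (∏ i, τ i ^ b i) • η = (∏ i, τ i) • ω := by
      rw [hη, smul_smul, ← Finset.prod_mul_distrib]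
      simp_rw [hbτ]
    rw [← h1, hg, smul_smul, hz, map_mul, map_prod]
    simp_rw [map_pow]
    rfl
  have hord := congrArg (fun η => (logCoefficient ι η).orderTop) key
  simp only [logCoefficient_smul, HahnSeries.orderTop_mul, hω, add_zero, Fin.prod_univ_two,
    map_mul] at hord
  have hle := le_orderTop_logCoefficient_dWedge ι (τ 0) (τ 1)
  -- Since `ord (dt₀ ∧ dt₁) ≥ ord t₀ + ord t₁` and these orders are finite, comparison with `t₀ t₁
  -- ω` gives `ord z ≤ 0`. A positive `b i` would put `z` in `𝔪`, where orders are positive.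
  have hz0 : ¬ 0 < (ι (algebraMap _ _ z)).orderTop := by
    intro hlt
    have hfin : (ι (τ 0)).orderTop + (ι (τ 1)).orderTop ≠ ⊤ := by
      refine WithTop.add_ne_top.mpr ⟨?_, ?_⟩ <;>
        exact HahnSeries.orderTop_ne_top.mpr ((map_ne_zero ι).mpr (hτ0 _))
    have h2 : (ι (algebraMap _ _ z)).orderTop + ((ι (τ 0)).orderTop + (ι (τ 1)).orderTop) ≤
        0 + ((ι (τ 0)).orderTop + (ι (τ 1)).orderTop) := by
      rw [zero_add]
      exact (add_le_add_right hle _).trans hord.symm.le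
    exact hlt.not_ge (WithTop.le_of_add_le_add_right hfin h2)
  have hbi : b i = 0 := by
    by_contra hbi
    refine hz0 (hpos z ?_)
    have hti : t i ∈ maximalIdeal (Y.left.presheaf.stalk y) := ht ▸ Ideal.subset_span ⟨i, rfl⟩
    refine Ideal.mem_of_dvd _ ?_ hti
    exact ((dvd_pow_self _ hbi).trans
      (Finset.dvd_prod_of_mem (fun i => t i ^ b i) (Finset.mem_univ i))).trans (dvd_mul_right _ _)
  have := ha i
  simp only [hb] at hbi
  omega

end Coefficients

/-- The centre of the monomial valuation is a node. -/
theorem exists_node {X Y : CScheme} [IsIntegral X.left] [SmoothOfRelativeDimension 2 X.hom]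
    [IsIntegral Y.left] [SmoothOfRelativeDimension 2 Y.hom] [IsProper Y.hom]
    (f : Y ⟶ X) [IsDominant f.left] {D : AlgebraicCycle X.left ℤ}
    (hsnc : IsSimpleNormalCrossing (boundaryDivisors f D))
    {ω : RationalForm X} (hω : IsPoleDivisor X ω D) {DY : AlgebraicCycle Y.left ℤ}
    (hDY : IsPoleDivisor Y (pullbackForm f ω) DY)
    {x₁ x₂ : Y.left.functionField} (hx₁ : x₁ ≠ 0) (hx₂ : x₂ ≠ 0) {c : ℂ} (hc : c ≠ 0)
    (e : (x₁⁻¹ * x₂⁻¹) • dWedge x₁ x₂ = algebraMap ℂ Y.left.functionField c • pullbackForm f ω)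
    {ι : Y.left.functionField →ₐ[ℂ] BiSeries} (h₁ : ι x₁ = BiSeries.monomial 1 0)
    (h₂ : ι x₂ = BiSeries.monomial 0 1) :
    ∃ (y : Y.left) (t : Fin 2 → Y.left.presheaf.stalk y) (F : Fin 2 → Y.left) (h : ∀ i, F i ⤳ y),
      HasComplexResidue (Y.left.presheaf.stalk y) ∧
      Ideal.span (Set.range t) = maximalIdeal (Y.left.presheaf.stalk y) ∧
      F 0 ≠ F 1 ∧ (∀ i, F i ∈ unitComponents DY) ∧ ∀ i, idealAt (h i) = Ideal.span {t i} := by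
  obtain ⟨y, hres, -, hpos⟩ := exists_center_of_algHom Y ι
  have := isNoetherianRing_stalk Y y
  have hord := orderTop_logCoefficient_eq_zero h₁ h₂ hc e
  have hω0 : pullbackForm f ω ≠ 0 := by
    intro h0
    rw [h0] at hord
    simp at hord
  obtain ⟨n, t, hdim, ht, hbd⟩ := hsnc y
  -- At most two by the bound on the dimension, and at least two since a nonzero 2-form exists.
  obtain rfl : n = 2 := by
    refine le_antisymm ?_ ?_
    · have := ringKrullDim_stalk_le_two hres
      rw [hdim] at this
      exact_mod_cast this
    · by_contra! hn
      exact hω0 (eq_zero_of_parameters_of_le_one hres (by omega) ht _)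
  have hdim : ringKrullDim (Y.left.presheaf.stalk y) = 2 := hdim
  choose F hF hFt using fun i =>
    exists_idealAt_eq (Ideal.span {t i}) (isPrime_span_of_regularSystem ht hdim i)
  have hF1 (i) : coheight (F i) = 1 := by
    rw [← height_idealAt (hF i), hFt, height_span_of_regularSystem ht hdim]
  have hle (i) : DY (F i) ≤ 1 := poleOrder_le_one (hF i) (hFt i)
    (ne_zero_of_regularSystem ht hdim i) (hF1 i) hDY hω0 hx₁ hx₂ hc e
  have hone := eq_one_of_orderTop_eq_zero hres ht hdim hle
    (fun E hE hE1 => zpow_mul_zpow_smul_mem_regularForms ht hdim hDY hFt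
      (fun E h hE1 hne => ?_) hE hE1) (hF 0) (hF1 0) hord hpos
  · refine ⟨y, t, F, hF, hres, ht, fun h01 => ?_, fun i => ⟨hF1 i, hone i⟩, hFt⟩
    have h01' : idealAt (hF 0) = idealAt (hF 1) := by
      congr 1
    rw [hFt, hFt, Ideal.span_singleton_eq_span_singleton] at h01'
    exact not_dvd_of_regularSystem ht hdim zero_ne_one h01'.dvd
  -- A curve through `y` other than the two is outside the boundary, so it maps onto a curve outside
  -- `Supp D`. There `ω` is regular, and so is its pullback.
  · have hE : E ∉ boundaryDivisors f D := fun hE => by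
      obtain ⟨i, hi⟩ := hbd E hE h
      exact hne i hi
    simp only [boundaryDivisors, Set.mem_ofPred_eq, not_and, not_or, not_not, not_exists] at hE
    obtain ⟨hfE, hD⟩ := hE hE1
    have := isNoetherianRing_stalk X (f.left E)
    refine pullbackForm_mem_regularForms f (hω.mem_regularForms hfE ?_)
    by_contra hD0
    exact hD _ hD0 specializes_rfl

/-! ### The point of the dual complex given by a node -/

section Node

theorem idealAt_le_idealAt {Y : Scheme} {F z y : Y} (hFz : F ⤳ z) (hzy : z ⤳ y) (hFy : F ⤳ y) :
    idealAt hFy ≤ idealAt hzy := by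
  intro a ha
  have e := congrArg (fun φ => φ.hom a) (Y.presheaf.stalkSpecializes_comp hFz hzy)
  have h1 : Y.presheaf.stalkSpecializes hzy a ∈ idealAt hFz := by
    rw [mem_idealAt_iff]
    rw [mem_idealAt_iff] at ha
    change (Y.presheaf.stalkSpecializes hzy ≫ Y.presheaf.stalkSpecializes hFz).hom a ∈ _
    rw [e]
    exact ha
  exact le_maximalIdeal (isPrime_idealAt hFz).ne_top h1

theorem eq_of_maximalIdeal_le_idealAt {Y : Scheme} {z y : Y} (hzy : z ⤳ y)
    (h : maximalIdeal (Y.presheaf.stalk y) ≤ idealAt hzy) : z = y := by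
  have h1 (w : Y) (hw : w ⤳ y) (hle : maximalIdeal (Y.presheaf.stalk y) ≤ idealAt hw) :
      idealAt hw = maximalIdeal (Y.presheaf.stalk y) :=
    le_antisymm (le_maximalIdeal (isPrime_idealAt hw).ne_top) hle
  refine eq_of_idealAt_eq (h := hzy) (h' := specializes_rfl) ?_
  rw [h1 z hzy h, h1 y specializes_rfl]
  intro a ha
  rw [mem_idealAt_iff, TopCat.Presheaf.stalkSpecializes_refl]
  exact ha

variable {Y : Scheme} {y : Y} {F : Fin 2 → Y} (hF : ∀ i, F i ⤳ y) (hne : F 0 ≠ F 1)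
  (hclosed : IsClosed {y})
  (hmax : ∀ P : Ideal (Y.presheaf.stalk y), (∀ i, idealAt (hF i) ≤ P) →
    maximalIdeal (Y.presheaf.stalk y) ≤ P)
  {D : AlgebraicCycle Y ℤ} (hD : ∀ i, F i ∈ unitComponents D)

include hF hclosed hmax in
-- The generic point of a larger irreducible set in the intersection specializes to `y`. Its prime
-- in the local ring at `y` contains both branch ideals, hence equals `𝔪`, so that point is `y`.
theorem maximal_singleton_of_node :
    Maximal (fun W : Set Y => IsIrreducible W ∧ W ⊆ ⋂ i, closure {F i}) {y} := by
  refine ⟨⟨isIrreducible_singleton, ?_⟩, fun W hW hyW w hw => ?_⟩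
  · rw [Set.singleton_subset_iff, Set.mem_iInter]
    exact fun i => (hF i).mem_closure
  · obtain ⟨z, hz⟩ := QuasiSober.sober hW.1.closure isClosed_closure
    have hzy : z ⤳ y := hz.specializes (subset_closure (hyW rfl))
    have hFz (i) : F i ⤳ z := by
      rw [specializes_iff_mem_closure]
      have h1 : closure W ⊆ closure {F i} :=
        closure_minimal (hW.2.trans (Set.iInter_subset _ i)) isClosed_closure
      exact h1 hz.mem
    obtain rfl := eq_of_maximalIdeal_le_idealAt hzy
      (hmax _ fun i => idealAt_le_idealAt (hFz i) hzy (hF i))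
    have h2 := hz.specializes (subset_closure hw)
    rw [specializes_iff_mem_closure, hclosed.closure_eq] at h2
    exact h2

/-- Barycentric coordinates that distinguish two vertices. -/
def edgeWeight (E₁ E₂ : Y) : Y →₀ ℝ :=
  Finsupp.single E₁ (1 / 3) + Finsupp.single E₂ (2 / 3)

open Classical in
theorem edgeWeight_apply (E₁ E₂ E : Y) : edgeWeight E₁ E₂ E =
    (if E₁ = E then 1 / 3 else 0) + if E₂ = E then 2 / 3 else 0 := by
  simp [edgeWeight, Finsupp.single_apply]

open Classical in
theorem support_edgeWeight (E₁ E₂ : Y) : (edgeWeight E₁ E₂).support = {E₁, E₂} := by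
  ext E
  rw [Finsupp.mem_support_iff, edgeWeight_apply, Finset.mem_insert, Finset.mem_singleton]
  split_ifs with h1 h2 h2
  · simp [h1]; norm_num
  · simp [h1]
  · simp [h2]
  · simp [Ne.symm h1, Ne.symm h2]

/-- A point of the open edge of the dual complex given by a node. -/
def nodePoint : DualComplex D where
  weight := edgeWeight (F 0) (F 1)
  support_subset E hE := by
    classical
    rw [support_edgeWeight, Finset.mem_insert, Finset.mem_singleton] at hE
    rcases hE with rfl | rfl
    exacts [hD 0, hD 1]
  weight_nonneg E := by
    classical
    rw [edgeWeight_apply]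
    split_ifs <;> norm_num
  weight_sum := by
    classical
    rw [support_edgeWeight, Finset.sum_pair hne, edgeWeight_apply, edgeWeight_apply]
    simp [hne, hne.symm]
    norm_num
  stratum := {y}
  maximal := by
    classical
    have h := maximal_singleton_of_node hF hclosed hmax
    have e : ⋂ E ∈ (edgeWeight (F 0) (F 1)).support, closure {E} = ⋂ i, closure {F i} := by
      rw [support_edgeWeight]
      ext z
      simp [Fin.forall_fin_two]
    rwa [← e] at h

include hne hclosed hmax hD in
/-- A map that acts trivially on the dual complex fixes the nodes and the components through
them. -/
theorem fixes_of_fixes_dualComplex (g : Y → Y)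
    (hg : ∀ p : DualComplex D, g '' p.stratum = p.stratum ∧ ∀ E, p.weight (g E) = p.weight E) :
    g y = y ∧ ∀ i, g (F i) = F i := by
  classical
  obtain ⟨h1, h2⟩ := hg (nodePoint hF hne hclosed hmax hD)
  have h3 : g '' {y} = {y} := h1
  have h4 (E) : edgeWeight (F 0) (F 1) (g E) = edgeWeight (F 0) (F 1) E := h2 E
  refine ⟨by simpa using h3, fun i => ?_⟩
  -- The weights `1/3`, `2/3` and `0` are distinct, so each vertex of the edge is determined by its
  -- weight and cannot be exchanged with the other.
  have h5 := h4 (F i)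
  rw [edgeWeight_apply, edgeWeight_apply] at h5
  fin_cases i
  · simp only [Fin.zero_eta, if_true, if_neg hne.symm] at h5 ⊢
    split_ifs at h5 with h6 h7 h7
    · exact h6.symm
    · exact h6.symm
    · norm_num at h5
    · norm_num at h5
  · simp only [Fin.mk_one, if_true, if_neg hne] at h5 ⊢
    split_ifs at h5 with h6 h7 h7
    · exact h7.symm
    · norm_num at h5
    · exact h7.symm
    · norm_num at h5

end Node

/-! ### Equivariance -/

/-- The constant is read off at `y`: if `a - c` were a unit at `f(y)`, its pullback would be a unit
at `y`. -/
theorem HasComplexResidue.of_pullback {X Y : CScheme} (f : Y ⟶ X) {y : Y.left}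
    (h : HasComplexResidue (Y.left.presheaf.stalk y)) :
    HasComplexResidue (X.left.presheaf.stalk (f.left y)) := by
  intro a
  obtain ⟨c, hc⟩ := h (f.left.stalkMap y a)
  refine ⟨c, fun hu => hc ?_⟩
  have h1 := hu.map (f.left.stalkMap y).hom
  have e : (f.left.stalkMap y).hom (algebraMap ℂ _ c) = algebraMap ℂ _ c :=
    congrArg (fun φ => φ.hom c) (stalkStructure_stalkMap f y)
  rw [map_sub, e] at h1
  exact h1

/-- An endomorphism fixing a point and a generization of it preserves the ideal of the latter. -/
theorem pullbackGerm_mem_idealAt {Y : CScheme} (g : Y ⟶ Y) {F y : Y.left} (h : F ⤳ y)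
    (hy : g.left y = y) (hF : g.left F = F) {a : Y.left.presheaf.stalk y} (ha : a ∈ idealAt h) :
    pullbackGerm g y y (specializes_of_eq hy) a ∈ idealAt h := by
  have e : (Y.left.presheaf.stalkSpecializes (specializes_of_eq hy) ≫ g.left.stalkMap y) ≫
      Y.left.presheaf.stalkSpecializes h = Y.left.presheaf.stalkSpecializes h ≫
        Y.left.presheaf.stalkSpecializes (specializes_of_eq hF) ≫ g.left.stalkMap F := by
    rw [Category.assoc, ← g.left.stalkSpecializes_stalkMap _ _ h,
      TopCat.Presheaf.stalkSpecializes_comp_assoc, TopCat.Presheaf.stalkSpecializes_comp_assoc]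
  have h1 := maximalIdeal_le_comap_pullbackGerm g F hF ((mem_idealAt_iff h).mp ha)
  rw [mem_idealAt_iff]
  have h2 := congrArg (fun φ => φ.hom a) e
  exact h2 ▸ h1

/-- Two generators of `𝔪` span `𝔪 / 𝔪²`, which has dimension two by smoothness. -/
theorem exists_cotangentBasis_of_span {X : CScheme} [SmoothOfRelativeDimension 2 X.hom]
    {x : X.left} (hres : HasComplexResidue (X.left.presheaf.stalk x))
    (t : Fin 2 → maximalIdeal (X.left.presheaf.stalk x))
    (ht : Ideal.span (Set.range fun i => (t i : X.left.presheaf.stalk x)) =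
      maximalIdeal (X.left.presheaf.stalk x)) :
    ∃ b : Module.Basis (Fin 2) ℂ (maximalIdeal (X.left.presheaf.stalk x)).Cotangent,
      ∀ i, b i = Ideal.toCotangent _ (t i) := by
  obtain ⟨b₀⟩ := nonempty_cotangentBasis hres
  have hcard : Fintype.card (Fin 2) =
      Module.finrank ℂ (maximalIdeal (X.left.presheaf.stalk x)).Cotangent :=
    (Module.finrank_eq_card_basis b₀).symm
  refine ⟨basisOfTopLeSpanOfCardEqFinrank (fun i => Ideal.toCotangent _ (t i)) ?_ hcard,
    fun i => congrFun (coe_basisOfTopLeSpanOfCardEqFinrank _ _ _) i⟩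
  rintro v -
  obtain ⟨⟨a, ha⟩, rfl⟩ := Ideal.toCotangent_surjective _ v
  have ha' := ha
  rw [← ht, Ideal.mem_span_range_iff_exists_fun] at ha'
  obtain ⟨r, hr⟩ := ha'
  have e : (⟨a, ha⟩ : maximalIdeal (X.left.presheaf.stalk x)) = ∑ i, r i • t i := by
    ext
    simp [← hr]
  rw [e, map_sum]
  refine sum_mem fun i _ => ?_
  rw [map_smul, hres.smul_cotangent]
  exact Submodule.smul_mem _ _ (Submodule.subset_span ⟨i, rfl⟩)

end CYSurface

end

/-! ### The main theorem -/

open CategoryTheory AlgebraicGeometry CYSurface in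
theorem mainTheorem9 (X : CScheme) [IsIntegral X.left] [SmoothOfRelativeDimension 2 X.hom]
    (D : AlgebraicCycle X.left ℤ) (hCY : IsCalabiYauPair X D)
    (hcrep : IsCrepantBirationalToPlane X D)
    (G : Subgroup (Aut X)) [Finite G] (hG : ∀ g ∈ G, IsPairAutomorphism X D g)
    (Y : CScheme) [IsIntegral Y.left] (f : Y ⟶ X) [IsDominant f.left]
    (hf : IsLogResolution f D)
    (ρ : G →* Aut Y) (hρ : ∀ g : G, (ρ g).hom ≫ f = f ≫ (g : Aut X).hom)
    (DY : AlgebraicCycle Y.left ℤ) (hDY : IsCrepantPullback f D DY) :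
    (∀ a ∈ dualComplexKernel ρ DY, ∀ b ∈ dualComplexKernel ρ DY, a * b = b * a) ∧
    Group.rank (dualComplexKernel ρ DY) ≤ 2 ∧
    ∃ y : Y.left, IsNode DY y ∧
      ActsFaithfullyAndDiagonallyAt (ρ.comp (dualComplexKernel ρ DY).subtype) y ∧
      ActsFaithfullyAndDiagonallyAt (G.subtype.comp (dualComplexKernel ρ DY).subtype)
        (f.left y) := by
  have hX : IsProper X.hom := hCY.proper
  have hfp : IsProper f.left := hf.proper
  have hY : IsProper Y.hom := by
    rw [← Over.w f]
    infer_instance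
  have hYs : SmoothOfRelativeDimension 2 Y.hom := hf.smooth
  obtain ⟨ω, hω, x₁, x₂, c, hc, hx₁, hx₂, e, ι, h₁, h₂⟩ := hcrep.exists_algHom f hf.birational
  obtain ⟨y, t, F, hF, hres, ht, hne, hDF, hFt⟩ :=
    exists_node f hf.snc hω (hDY ω hω) hx₁ hx₂ hc e h₁ h₂
  have hclosed : IsClosed {y} := isClosed_singleton_of_hasComplexResidue hres
  have hmax (P : Ideal (Y.left.presheaf.stalk y)) (hP : ∀ i, idealAt (hF i) ≤ P) :
      IsLocalRing.maximalIdeal (Y.left.presheaf.stalk y) ≤ P := by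
    rw [← ht, Ideal.span_le]
    rintro _ ⟨i, rfl⟩
    exact hP i (by rw [hFt]; exact Ideal.mem_span_singleton_self _)
  have := isNoetherianRing_stalk Y y
  have := isNoetherianRing_stalk X (f.left y)
  let H := dualComplexKernel ρ DY
  let σY : H →* Aut Y := ρ.comp H.subtype
  let σX : H →* Aut X := G.subtype.comp H.subtype
  have hfix (h : H) := fixes_of_fixes_dualComplex hF hne hclosed hmax hDF _ h.2
  have hy (h : H) : (σY h).hom.left y = y := (hfix h).1
  have hequi (h : H) : (σY h).hom ≫ f = f ≫ (σX h).hom := hρ h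
  have hfy (h : H) : (σX h).hom.left (f.left y) = f.left y := by
    have h1 := congrArg (fun k : Y ⟶ X => k.left y) (hequi h)
    simp only [Over.comp_left, Scheme.Hom.comp_apply, hy h] at h1
    exact h1.symm
  have hσX (h : H) (h1 : (σX h).hom = 𝟙 X) : h = 1 := by
    apply Subtype.ext
    apply Subtype.ext
    exact Iso.ext h1
  -- If `h` is trivial on `Y`, equivariance gives `f = f ≫ h`. As `f` is dominant and `X` is reduced
  -- and separated, `h` is trivial on `X`.
  have hσY (h : H) (h1 : (σY h).hom = 𝟙 Y) : h = 1 := by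
    apply hσX
    have h2 := hequi h
    rw [h1, Category.id_comp] at h2
    apply CategoryTheory.Over.OverMorphism.ext
    refine ext_of_isDominant_of_isSeparated X.hom (by simp) f.left ?_
    have h3 := congrArg (fun k : Y ⟶ X => k.left) h2
    simpa using h3.symm
  have htm (i) : t i ∈ IsLocalRing.maximalIdeal (Y.left.presheaf.stalk y) :=
    ht ▸ Ideal.subset_span ⟨i, rfl⟩
  obtain ⟨b, hb⟩ := exists_cotangentBasis_of_span hres (fun i => ⟨t i, htm i⟩) ht
  -- The kernel fixes each component through `y` separately, so it preserves each ideal `(t i)`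
  -- instead of merely permuting the two.
  have hdiv (h : H) (i : Fin 2) : t i ∣ germAction σY hy h (t i) := by
    rw [← Ideal.mem_span_singleton, ← hFt]
    exact pullbackGerm_mem_idealAt _ (hF i) (hy h) ((hfix h).2 i)
      (by rw [hFt]; exact Ideal.mem_span_singleton_self _)
  obtain ⟨d, hd⟩ := exists_diagonal_basis σY hy hres b (fun i => ⟨t i, htm i⟩) hb hdiv
  have hfaith := eq_one_of_tangentMap_eq_id σY hy hres hσY
  obtain ⟨hcomm, hrank⟩ := commute_and_rank_le_two_of_diagonal (tangentAction σY hy) hfaith d hd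
  have hresX : HasComplexResidue (X.left.presheaf.stalk (f.left y)) := hres.of_pullback f
  obtain ⟨bX⟩ := nonempty_cotangentBasis hresX
  refine ⟨fun g hg h hh => congrArg Subtype.val (hcomm ⟨g, hg⟩ ⟨h, hh⟩), hrank, y,
    ⟨hclosed, F 0, hDF 0, F 1, hDF 1, hne, hF 0, hF 1⟩, ⟨hy, hfaith, d, hd⟩,
    actsFaithfullyAndDiagonallyAt_of_commute σX hresX bX hσX hcomm hfy⟩
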